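/- Let $M$ be a smooth oriented $n$-manifold. Let $\Lambda^{\star a}$ be the space of smooth $a$-vector fields (completely antisymmetric contravariant tensor fields of order $a$) on $M$, with $\Lambda^{\star a}=0$ for $a<0$, and let $(\Lambda^{\star}=\bigoplus_a\Lambda^{\star a},\wedge)$ be the exterior contravariant algebra. For a $k$-form $\beta$ and $A\in\Lambda^{\star a}$ with $a\le k$ let $(\beta,A)$ be the $(k-a)$-form $\frac{1}{a!}\beta_{i_1\dots i_{k-a}\,j_1\dots j_a}A^{j_1\dots j_a}$ (contraction of the last $a$ slots of $\beta$), and put $(\beta,A)=0$ if $a>k$; for $P\in\Lambda^{\star k}$ and a $c$-form $\alpha$ with $c\le k$ let $(P,\alpha)=\frac{1}{c!}P^{i_1\dots i_{k-c}\,j_1\dots j_c}\alpha_{j_1\dots j_c}$, and put $(P,\alpha)=0$ if $c>k$. For $C\in\Lambda^{\star k}$ and a $k$-form $\gamma$ write $i(C)\gamma=(\gamma,C)$ for the full contraction. Let $\eta$ be a volume element (a nowhere vanishing smooth $n$-form), let $\epsilon=\pm1$, and let $\eta^{\star}$ be the dual $n$-vector field, $\frac{1}{n!}\eta_{i_1\dots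 i_n}\eta^{\star\, i_1\dots i_n}=\epsilon$. Put $\ast A=(\eta,A)$ for multivector fields $A$ and $\ast\alpha=(\eta^{\star},\alpha)$ for forms $\alpha$. The codifferential is the $\mathbb{R}$-linear operator $\delta$ of degree $-1$ on $\Lambda^{\star}$ with $\delta A=\epsilon(-1)^{na}\ast d\ast A$ for $A\in\Lambda^{\star a}$. Its Leibniz bracket with respect to $\wedge$ is $$\{A,B\}_{\delta}=A\wedge\delta B+(-1)^{a}\big[\delta A\wedge B-\delta(A\wedge B)\big],\qquad A\in\Lambda^{\star a},\ B\in\Lambda^{\star}.$$ For $A\in\Lambda^{\star a}$ and $B\in\Lambda^{\star b}$ the Schouten bracket $\{A,B\}$ is the multivector field in $\Lambda^{\star\, a+b-1}$ such that, for every closed $(a+b-1)$-form $\gamma$ on $M$, $$i(\{A,B\})\gamma=(d(\gamma,B),A)+(-1)^{ab}(d(\gamma,A),B).$$ **Theorem.** For all $a,b\ge 0$, $A\in\Lambda^{\star a}$ and $B\in\Lambda^{\star b}$, the Schouten bracket $\{A,B\}$ is well defined (it exists and is unique), and up to the factor $(-1)^a$ it is the Leibniz bracket of $\delta$ on $(\Lambda^{\star},\wedge)$: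 $\{A,B\}=(-1)^{a}\{A,B\}_{\delta}$. Explicitly, $$\{A,B\}=\delta A\wedge B+(-1)^{a}A\wedge\delta B-\delta(A\wedge B).$$ -/

import Mathlib

open scoped Manifold ContDiff

noncomputable section

namespace LeibnizSchouten

/-! ### Leibniz bracket of an operator -/

/-- The Leibniz bracket `𝓛_P⟨∘⟩(A, B) = A ∘ P(B) + (-1)^{p(a+k)} [P(A) ∘ B - P(A ∘ B)]` of an
operator `P` of degree `p` with respect to an operation `op` of degree `k` on a graded abelian
group, evaluated on an element `A` that is homogeneous of degree `a` and on an element `B`. -/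
def leibnizBracket {E : Type*} [AddCommGroup E] (p k : ℤ) (P : E → E) (op : E → E → E)
    (a : ℤ) (A B : E) : E :=
  op A (P B) + (p * (a + k)).negOnePow • (op (P A) B - P (op A B))

/-! ### Linear algebra in one tangent space

A `k`-form on `V` is a continuous alternating map in `k` arguments; a multivector is an element of
the exterior algebra of `V`, and a multivector of degree `k` is an element of `⋀[ℝ]^k V`. -/

section LinearAlgebra

variable {V : Type*} [AddCommGroup V] [Module ℝ V]

/-- The multivectors of degree `k`, for an integer `k`: they are `0` when `k < 0`. -/
def multivectors (V : Type*) [AddCommGroup V] [Module ℝ V] (k : ℤ) :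
    Submodule ℝ (ExteriorAlgebra ℝ V) :=
  if 0 ≤ k then ⋀[ℝ]^k.toNat V else ⊥

/-- The full contraction of a `k`-form with multivectors: the linear functional with
`v₁ ∧ ⋯ ∧ v_k ↦ β (v₁, …, v_k)`, which is `(1/k!) β_{i₁…i_k} A^{i₁…i_k}` on a multivector `A` of
degree `k`, and which vanishes on multivectors of any other degree. -/
def pairing {k : ℕ} (β : V [⋀^Fin k]→ₗ[ℝ] ℝ) : ExteriorAlgebra ℝ V →ₗ[ℝ] ℝ :=
  ExteriorAlgebra.liftAlternating (Pi.single k β)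

variable [TopologicalSpace V] [IsTopologicalAddGroup V] [ContinuousSMul ℝ V] [T2Space V]
  [FiniteDimensional ℝ V]

/-- Alternating forms on a finite-dimensional space are continuous. -/
theorem continuous_alternating {k : ℕ} (f : V [⋀^Fin k]→ₗ[ℝ] ℝ) : Continuous f := by
  have key : ∀ v : Fin k → V, f v = ∑ r : Fin k → Fin (Module.finrank ℝ V),
      (∏ i, (Module.finBasis ℝ V).repr (v i) (r i)) •
        f (fun i => Module.finBasis ℝ V (r i)) := by
    intro v
    have h1 : v = fun i => ∑ j, (Module.finBasis ℝ V).repr (v i) j • Module.finBasis ℝ V j := by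
      funext i
      exact ((Module.finBasis ℝ V).sum_repr (v i)).symm
    conv_lhs => rw [h1]
    change f.toMultilinearMap _ = _
    rw [MultilinearMap.map_sum]
    refine Finset.sum_congr rfl fun r _ => ?_
    rw [MultilinearMap.map_smul_univ]
    rfl
  have key' : (f : (Fin k → V) → ℝ) = fun v => _ := funext key
  rw [key']
  refine continuous_finsetSum _ fun r _ => Continuous.smul (M := ℝ) ?_ continuous_const
  refine continuous_finsetProd _ fun i _ => ?_
  exact (LinearMap.continuous_of_finiteDimensional ((Module.finBasis ℝ V).coord (r i))).comp
    (continuous_apply i)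

/-- The interior product `(β, A)` of a `k`-form `β` with a multivector `A`, as a form of degree `m`:
`(β, A) (v₁, …, v_m) = ⟨β, v₁ ∧ ⋯ ∧ v_m ∧ A⟩`. For `A` of degree `a` and `k = m + a` it contracts
the last `a` slots of `β` with `A`, `(β, A)_{m} = (1/a!) β_{m,a} A^{a}`; for `A` of degree `a`
with `k ≠ m + a` it is `0`. -/
def interior {k : ℕ} (β : V [⋀^Fin k]→L[ℝ] ℝ) (A : ExteriorAlgebra ℝ V) (m : ℕ) :
    V [⋀^Fin m]→L[ℝ] ℝ :=
  let f : V [⋀^Fin m]→ₗ[ℝ] ℝ :=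
    ((pairing β.toAlternatingMap).comp (LinearMap.mulRight ℝ A)).compAlternatingMap
      (ExteriorAlgebra.ιMulti ℝ m)
  { f with cont := continuous_alternating f }

/-- The interior product `(P, α)` of a multivector `P` with a `c`-form `α`, as a multivector: on
multivectors `P` of degree `k ≥ c` it contracts the last `c` slots of `P` with `α`,
`(P, α)^{k-c} = (1/c!) P^{k-c,c} α_c`, that is, `v₁ ∧ ⋯ ∧ v_k` is mapped to
`∑ sign(σ) α(v_{σ(k-c+1)}, …, v_{σ(k)}) v_{σ(1)} ∧ ⋯ ∧ v_{σ(k-c)}`, the sum being over the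
`(k-c, c)`-shuffles `σ`; on multivectors of degree `k < c` it is `0`. -/
def contract {c : ℕ} (P : ExteriorAlgebra ℝ V) (α : V [⋀^Fin c]→L[ℝ] ℝ) : ExteriorAlgebra ℝ V :=
  ExteriorAlgebra.liftAlternating (fun k =>
    if h : c ≤ k then
      (((TensorProduct.rid ℝ (ExteriorAlgebra ℝ V)).toLinearMap.compAlternatingMap
        ((ExteriorAlgebra.ιMulti ℝ (M := V) (k - c)).domCoprod α.toAlternatingMap)).domDomCongr
          (finSumFinEquiv.trans (finCongr (Nat.sub_add_cancel h))))
    else 0) P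

end LinearAlgebra

/-! ### Forms and multivector fields on a manifold -/

section Manifold

variable {n : ℕ} {M : Type*} [TopologicalSpace M] [ChartedSpace (EuclideanSpace ℝ (Fin n)) M]

instance tangentSpace_finiteDimensional (x : M) : FiniteDimensional ℝ (TangentSpace (𝓡 n) x) :=
  inferInstanceAs (FiniteDimensional ℝ (EuclideanSpace ℝ (Fin n)))

instance tangentSpace_t2Space (x : M) : T2Space (TangentSpace (𝓡 n) x) :=
  inferInstanceAs (T2Space (EuclideanSpace ℝ (Fin n)))

variable (n M) in
/-- Fields of alternating covariant tensors of order `k` on `M` (no regularity). -/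
abbrev FormField (k : ℕ) : Type _ := (x : M) → TangentSpace (𝓡 n) x [⋀^Fin k]→L[ℝ] ℝ

variable (n M) in
/-- Fields of multivectors on `M` (no regularity, not necessarily homogeneous). With the pointwise
operations this is a ring, whose product is the exterior product. -/
abbrev MultivectorField : Type _ := (x : M) → ExteriorAlgebra ℝ (TangentSpace (𝓡 n) x)

/-- A field of `k`-forms read in the preferred chart `φ` at `x₀`, i.e. its pull-back by `φ⁻¹`. -/
def formInChart {k : ℕ} (α : FormField n M k) (x₀ : M) (y : EuclideanSpace ℝ (Fin n)) :
    EuclideanSpace ℝ (Fin n) [⋀^Fin k]→L[ℝ] ℝ :=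
  (α ((extChartAt (𝓡 n) x₀).symm y)).compContinuousLinearMap
    (mfderiv 𝓘(ℝ, EuclideanSpace ℝ (Fin n)) (𝓡 n) (extChartAt (𝓡 n) x₀).symm y)

/-- A field of multivectors read in the preferred chart `φ` at `x₀`, i.e. its push-forward
by `φ`. -/
def multivectorInChart (A : MultivectorField n M) (x₀ : M) (y : EuclideanSpace ℝ (Fin n)) :
    ExteriorAlgebra ℝ (EuclideanSpace ℝ (Fin n)) :=
  ExteriorAlgebra.map
    (mfderiv (𝓡 n) 𝓘(ℝ, EuclideanSpace ℝ (Fin n)) (extChartAt (𝓡 n) x₀)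
      ((extChartAt (𝓡 n) x₀).symm y) :
        TangentSpace (𝓡 n) ((extChartAt (𝓡 n) x₀).symm y) →L[ℝ] EuclideanSpace ℝ (Fin n)).toLinearMap
    (A ((extChartAt (𝓡 n) x₀).symm y))

/-- Smooth differential forms. -/
def IsSmoothForm {k : ℕ} (α : FormField n M k) : Prop :=
  ∀ x₀ : M, ContDiffOn ℝ ∞ (formInChart α x₀) (extChartAt (𝓡 n) x₀).target

/-- Smooth multivector fields of degree `k`: smoothness means that all components (equivalently,
all linear functionals of the values) in charts are smooth. -/
structure IsMultivectorField (k : ℤ) (A : MultivectorField n M) : Prop where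
  mem : ∀ x : M, A x ∈ multivectors (TangentSpace (𝓡 n) x) k
  smooth : ∀ (x₀ : M) (l : Module.Dual ℝ (ExteriorAlgebra ℝ (EuclideanSpace ℝ (Fin n)))),
    ContDiffOn ℝ ∞ (fun y => l (multivectorInChart A x₀ y)) (extChartAt (𝓡 n) x₀).target

/-- The exterior derivative of a differential form on a manifold. Its value at `x` is computed in
the preferred chart at `x`. -/
def extDerivative {k : ℕ} (α : FormField n M k) : FormField n M (k + 1) := fun x =>
  (extDeriv (formInChart α x) (extChartAt (𝓡 n) x x)).compContinuousLinearMap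
    (mfderiv (𝓡 n) 𝓘(ℝ, EuclideanSpace ℝ (Fin n)) (extChartAt (𝓡 n) x) x :
      TangentSpace (𝓡 n) x →L[ℝ] EuclideanSpace ℝ (Fin n))

/-- The function `i(A) β`, full contraction of a `k`-form with a multivector field of
degree `k`. -/
def pairingField {k : ℕ} (β : FormField n M k) (A : MultivectorField n M) : M → ℝ :=
  fun x => pairing (β x).toAlternatingMap (A x)

/-- The form `(β, A)` of degree `m` (meaningful for `β` of degree `m + a`, `A` of degree `a`). -/
def interiorField {k : ℕ} (β : FormField n M k) (A : MultivectorField n M) (m : ℕ) :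
    FormField n M m :=
  fun x => interior (β x) (A x) m

/-- The multivector field `(P, α)`. -/
def contractField {c : ℕ} (P : MultivectorField n M) (α : FormField n M c) :
    MultivectorField n M :=
  fun x => contract (P x) (α x)

/-! ### Volume element, Hodge operators, codifferential -/

/-- A covariant volume element: a smooth nowhere vanishing `n`-form. -/
def IsVolumeElement (η : FormField n M n) : Prop :=
  IsSmoothForm η ∧ ∀ x, η x ≠ 0

/-- `ηs` is the contravariant dual of `η` with sign `ε`: it is the `n`-vector field whose full
contraction with `η` is the constant `ε`, `(1/n!) η_{i₁…i_n} ηs^{i₁…i_n} = ε`. -/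
def IsDualVolumeElement (ε : ℝ) (η : FormField n M n) (ηs : MultivectorField n M) : Prop :=
  ∀ x, ηs x ∈ multivectors (TangentSpace (𝓡 n) x) n ∧ pairing (η x).toAlternatingMap (ηs x) = ε

/-- Hodge operator `*A = (η, A)` on multivector fields of degree `a`. -/
def hodgeMultivector (η : FormField n M n) (a : ℕ) (A : MultivectorField n M) :
    FormField n M (n - a) :=
  interiorField η A (n - a)

/-- Hodge operator `*α = (ηs, α)` on forms. -/
def hodgeForm (ηs : MultivectorField n M) {c : ℕ} (α : FormField n M c) : MultivectorField n M :=
  contractField ηs α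

/-- The homogeneous component of degree `a` of a field of multivectors. -/
def component (a : ℕ) (A : MultivectorField n M) : MultivectorField n M :=
  fun x => GradedAlgebra.proj (fun i : ℕ => ⋀[ℝ]^i (TangentSpace (𝓡 n) x)) a (A x)

/-- The codifferential, equal to `ε (-1)^{n a} * d *` on multivector fields of degree `a`. -/
def codifferential (ε : ℝ) (η : FormField n M n) (ηs : MultivectorField n M)
    (A : MultivectorField n M) : MultivectorField n M :=
  ∑ a ∈ Finset.range (n + 1),
    (ε * (-1) ^ (n * a)) •
      hodgeForm ηs (extDerivative (hodgeMultivector η a (component a A)))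

/-! ### Schouten bracket -/

/-- `C` is a Schouten bracket of the multivector fields `A`, `B` of degrees `a`, `b`: it is a
smooth multivector field of degree `a + b - 1` and, for every closed form `γ` of that degree,
`i(C) γ = (d (γ, B), A) + (-1)^{ab} (d (γ, A), B)`.
If `a = 0` then `γ` has degree `b - 1 < b`, so `(γ, B)` vanishes and so does the first term,
whatever the value of `a - 1`; likewise for the second term if `b = 0`. If `a = b = 0` then the
degree is `-1` and the condition is `C = 0`. -/
def IsSchoutenBracket (a b : ℕ) (A B C : MultivectorField n M) : Prop :=
  IsMultivectorField ((a : ℤ) + b - 1) C ∧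
    ∀ (k : ℕ), k + 1 = a + b → ∀ γ : FormField n M k, IsSmoothForm γ → extDerivative γ = 0 →
      pairingField γ C =
        pairingField (extDerivative (interiorField γ B (a - 1))) A +
          (-1 : ℝ) ^ (a * b) • pairingField (extDerivative (interiorField γ A (b - 1))) B

/-- The Schouten bracket `{A, B}` of multivector fields of degrees `a` and `b`: the multivector
field determined by its action on closed forms. -/
def schoutenBracket (a b : ℕ) (A B : MultivectorField n M) : MultivectorField n M :=
  Classical.epsilon (IsSchoutenBracket a b A B)

end Manifold

end LeibnizSchouten

end

open LeibnizSchouten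

/-! Fix a point, its preferred chart and a basis `e` of the tangent space, and let ∂_i be
differentiation of chart components along e_i. Forms of top degree span a line, so ∂_i η = r_i η at
the point, and the codifferential becomes a divergence, δA = -∑ e^i⌟(∂_i A + r_i A)
(`codifferential_apply`). Two facts of linear algebra give this: (η*, (η, Q)) is a constant multiple
of Q (`contract_interior`), and e^i ∧ (η, P) = ±(η, e^i⌟P), because a product of degree n + 1
vanishes (`pairing_interior_icontr`). Since e^i⌟ is an antiderivation and ∂_i a derivation, in δA∧B
+ (-1)^a A∧δB - δ(A∧B) all r_i terms cancel, and so do the terms where e^i⌟ and ∂_i hit the same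
factor. What is left is ∑ ((e^i⌟A)∧∂_i B + (-1)^a ∂_i A∧(e^i⌟B)), in which η no longer appears
(`divergence_defect`).

On the other side, dα = ∑ e^i ∧ ∂_i α, and e^i ∧ is adjoint to e^i⌟ (`pairing_extDerivative`). When
d(γ, B) and d(γ, A) are expanded, the derivatives of A and B produce γ paired with the same sum,
while the derivatives of γ assemble into dγ paired with A∧B, which is zero
(`pairing_pointwiseSchouten`). So the explicit expression satisfies the defining identity.

Uniqueness and smoothness need enough closed forms. A bump function extends a chart near a point to
a global smooth map, and pull-backs of constant forms along it are closed and constant in the chart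
near the point (`exists_closed_form`). They realise every alternating form at the point, whence
uniqueness. They also express each chart component of the candidate locally as the right-hand side
of the defining identity, which is smooth; smoothness of δA need not be treated separately. -/

namespace LeibnizSchouten

/-! ### Exterior algebra: full contraction, graded commutativity, contraction with a covector. -/

section Algebra

variable {V W : Type*} [AddCommGroup V] [Module ℝ V] [AddCommGroup W] [Module ℝ W]

open ExteriorAlgebra

instance finite_exteriorAlgebra [FiniteDimensional ℝ V] :
    Module.Finite ℝ (ExteriorAlgebra ℝ V) :=
  Module.Finite.of_basis (Module.Basis.ExteriorAlgebra (Module.finBasis ℝ V))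

theorem pairing_ιMulti {k : ℕ} (β : V [⋀^Fin k]→ₗ[ℝ] ℝ) (v : Fin k → V) :
    pairing β (ιMulti ℝ k v) = β v := by
  simp [pairing, liftAlternating_apply_ιMulti]

theorem pairing_ιMulti_of_ne {j k : ℕ} (h : j ≠ k) (β : V [⋀^Fin k]→ₗ[ℝ] ℝ) (v : Fin j → V) :
    pairing β (ιMulti ℝ j v) = 0 := by
  simp [pairing, liftAlternating_apply_ιMulti, Pi.single_eq_of_ne h]

theorem ιMulti_mem (k : ℕ) (v : Fin k → V) : ιMulti ℝ k v ∈ ⋀[ℝ]^k V :=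
  ιMulti_range ℝ k ⟨v, rfl⟩

-- The exterior power is spanned by decomposable multivectors, so a linear statement need only be
-- checked on those.
@[elab_as_elim]
theorem exteriorPower_induction {k : ℕ} {p : (P : ExteriorAlgebra ℝ V) → P ∈ ⋀[ℝ]^k V → Prop}
    (hι : ∀ v, p (ιMulti ℝ k v) (ιMulti_mem k v)) (h0 : p 0 (zero_mem _))
    (hadd : ∀ x y hx hy, p x hx → p y hy → p (x + y) (add_mem hx hy))
    (hsmul : ∀ (r : ℝ) x hx, p x hx → p (r • x) (Submodule.smul_mem _ r hx))
    {P : ExteriorAlgebra ℝ V} (hP : P ∈ ⋀[ℝ]^k V) : p P hP := by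
  have hP' := hP
  rw [← ιMulti_span_fixedDegree] at hP'
  -- The predicate depends on the membership proof; bundling that proof existentially leaves a
  -- predicate on P alone for span induction.
  suffices h : ∃ h, p P h from h.2
  induction hP' using Submodule.span_induction with
  | mem x hx => obtain ⟨v, rfl⟩ := hx; exact ⟨_, hι v⟩
  | zero => exact ⟨_, h0⟩
  | add x y hx hy hx' hy' =>
    rw [ιMulti_span_fixedDegree] at hx hy
    exact ⟨_, hadd x y hx hy (hx' hx).2 (hy' hy).2⟩
  | smul r x hx hx' =>
    rw [ιMulti_span_fixedDegree] at hx
    exact ⟨_, hsmul r x hx (hx' hx).2⟩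

theorem pairing_eq_zero_of_mem {j k : ℕ} (h : j ≠ k) (β : V [⋀^Fin k]→ₗ[ℝ] ℝ)
    {P : ExteriorAlgebra ℝ V} (hP : P ∈ ⋀[ℝ]^j V) : pairing β P = 0 := by
  induction hP using exteriorPower_induction with
  | hι v => exact pairing_ιMulti_of_ne h β v
  | h0 => simp
  | hadd x y _ _ hx hy => simp [hx, hy]
  | hsmul r x _ hx => simp [hx]

theorem pairing_add {k : ℕ} (β γ : V [⋀^Fin k]→ₗ[ℝ] ℝ) (P : ExteriorAlgebra ℝ V) :
    pairing (β + γ) P = pairing β P + pairing γ P := by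
  simp [pairing, Pi.single_add]

theorem pairing_smul {k : ℕ} (r : ℝ) (β : V [⋀^Fin k]→ₗ[ℝ] ℝ) (P : ExteriorAlgebra ℝ V) :
    pairing (r • β) P = r * pairing β P := by
  simp [pairing, Pi.single_smul]

theorem pairing_zero {k : ℕ} (P : ExteriorAlgebra ℝ V) :
    pairing (0 : V [⋀^Fin k]→ₗ[ℝ] ℝ) P = 0 := by
  simp [pairing]

theorem dual_apply_eq_pairing {k : ℕ} (l : Module.Dual ℝ (ExteriorAlgebra ℝ V))
    {P : ExteriorAlgebra ℝ V} (hP : P ∈ ⋀[ℝ]^k V) :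
    l P = pairing (l.compAlternatingMap (ιMulti ℝ k)) P := by
  induction hP using exteriorPower_induction with
  | hι v => simp [pairing_ιMulti]
  | h0 => simp
  | hadd x y _ _ hx hy => simp [hx, hy]
  | hsmul r x _ hx => simp [hx]

/-- Multivectors of degree `k` are separated by the alternating forms of degree `k`. -/
theorem eq_of_pairing_eq {k : ℕ} {P Q : ExteriorAlgebra ℝ V} (hP : P ∈ ⋀[ℝ]^k V)
    (hQ : Q ∈ ⋀[ℝ]^k V) (h : ∀ β : V [⋀^Fin k]→ₗ[ℝ] ℝ, pairing β P = pairing β Q) : P = Q := by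
  refine sub_eq_zero.1 ((Module.forall_dual_apply_eq_zero_iff ℝ (P - Q)).1 fun l => ?_)
  rw [map_sub, dual_apply_eq_pairing l hP, dual_apply_eq_pairing l hQ, h, sub_self]

theorem ι_mul_mem {p : ℕ} (u : V) {P : ExteriorAlgebra ℝ V} (hP : P ∈ ⋀[ℝ]^p V) :
    P * ι ℝ u = (-1 : ℝ) ^ p • (ι ℝ u * P) := by
  induction hP using exteriorPower_induction with
  | hι v =>
    induction p with
    | zero => simp
    | succ p ih =>
      rw [ιMulti_succ_apply, mul_assoc, ih, mul_smul_comm, ← mul_assoc, ← mul_assoc,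
        eq_neg_of_add_eq_zero_left (ι_add_mul_swap (v 0) u), pow_succ]
      simp
  | h0 => simp
  | hadd x y _ _ hx hy => simp [add_mul, mul_add, hx, hy]
  | hsmul r x _ hx => simp [hx, smul_comm r]

/-- Each vector factor of Q passes P at the cost of (-1)^p, and there are q of them. -/
theorem mul_comm_of_mem {p q : ℕ} {P Q : ExteriorAlgebra ℝ V} (hP : P ∈ ⋀[ℝ]^p V)
    (hQ : Q ∈ ⋀[ℝ]^q V) : P * Q = (-1 : ℝ) ^ (p * q) • (Q * P) := by
  induction hQ using exteriorPower_induction with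
  | hι v =>
    induction q with
    | zero => simp
    | succ q ih =>
      rw [ιMulti_succ_apply, ← mul_assoc, ι_mul_mem _ hP, smul_mul_assoc, mul_assoc, ih, mul_assoc,
        mul_smul_comm, smul_smul, mul_add_one, pow_add, mul_comm]
  | h0 => simp
  | hadd x y _ _ hx hy => simp [add_mul, mul_add, hx, hy]
  | hsmul r x _ hx => simp [hx, smul_comm r]

/-- The interior product of a covector with a multivector, contracting the first slot. -/
noncomputable def icontr (d : Module.Dual ℝ V) : ExteriorAlgebra ℝ V →ₗ[ℝ] ExteriorAlgebra ℝ V :=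
  CliffordAlgebra.contractLeft (Q := (0 : QuadraticForm ℝ V)) d

theorem icontr_one (d : Module.Dual ℝ V) : icontr d 1 = 0 :=
  CliffordAlgebra.contractLeft_one (Q := (0 : QuadraticForm ℝ V)) d

theorem icontr_ι_mul (d : Module.Dual ℝ V) (u : V) (P : ExteriorAlgebra ℝ V) :
    icontr d (ι ℝ u * P) = d u • P - ι ℝ u * icontr d P :=
  CliffordAlgebra.contractLeft_ι_mul _ _ _

theorem icontr_ιMulti (d : Module.Dual ℝ V) {k : ℕ} (v : Fin (k + 1) → V) :
    icontr d (ιMulti ℝ (k + 1) v) =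
      ∑ j : Fin (k + 1), ((-1 : ℝ) ^ (j : ℕ) * d (v j)) • ιMulti ℝ k (j.removeNth v) := by
  induction k with
  | zero =>
    have h := icontr_ι_mul d (v 0) 1
    rw [mul_one, icontr_one, mul_zero, sub_zero] at h
    simp [ιMulti_succ_apply, h]
  | succ k ih =>
    rw [ιMulti_succ_apply, icontr_ι_mul, ih, Finset.mul_sum,
      Fin.sum_univ_succ (n := k + 1), sub_eq_add_neg, ← Finset.sum_neg_distrib]
    congr 1
    · simp [Fin.removeNth_zero, Matrix.vecTail, Fin.tail_def]
      rfl
    · refine Finset.sum_congr rfl fun j _ => ?_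
      rw [mul_smul_comm, ιMulti_succ_apply (v := j.succ.removeNth v), ← neg_smul]
      congr 2
      · simp [pow_succ, Matrix.vecTail]
      · congr 1
        funext i
        simp [Matrix.vecTail, Fin.removeNth_apply]

theorem icontr_mem (d : Module.Dual ℝ V) {k : ℕ} {P : ExteriorAlgebra ℝ V}
    (hP : P ∈ ⋀[ℝ]^(k + 1) V) : icontr d P ∈ ⋀[ℝ]^k V := by
  induction hP using exteriorPower_induction with
  | hι v =>
    rw [icontr_ιMulti]
    exact Submodule.sum_mem _ fun j _ => Submodule.smul_mem _ _ (ιMulti_mem _ _)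
  | h0 => simp
  | hadd x y _ _ hx hy => simpa using add_mem hx hy
  | hsmul r x _ hx => simpa using Submodule.smul_mem _ r hx

theorem icontr_of_mem_zero (d : Module.Dual ℝ V) {P : ExteriorAlgebra ℝ V}
    (hP : P ∈ ⋀[ℝ]^0 V) : icontr d P = 0 := by
  induction hP using exteriorPower_induction with
  | hι v => simp [icontr_one]
  | h0 => simp
  | hadd x y _ _ hx hy => simp [hx, hy]
  | hsmul r x _ hx => simp [hx]

/-- In degree 0 the contraction is zero and hence lies in every degree. The truncated `a - 1` and `b
- 1` are therefore harmless, and the cases a = 0 and b = 0 need no separate treatment. -/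
theorem icontr_mem_pred (d : Module.Dual ℝ V) {k : ℕ} {P : ExteriorAlgebra ℝ V}
    (hP : P ∈ ⋀[ℝ]^k V) : icontr d P ∈ ⋀[ℝ]^(k - 1) V := by
  cases k with
  | zero => rw [icontr_of_mem_zero d hP]; exact zero_mem _
  | succ k => exact icontr_mem d hP

/-- The antiderivation rule, by induction on the number of vector factors of P. It is the algebraic
source of the Schouten bracket. -/
theorem icontr_mul (d : Module.Dual ℝ V) {p : ℕ} {P : ExteriorAlgebra ℝ V} (hP : P ∈ ⋀[ℝ]^p V)
    (Q : ExteriorAlgebra ℝ V) :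
    icontr d (P * Q) = icontr d P * Q + (-1 : ℝ) ^ p • (P * icontr d Q) := by
  induction hP using exteriorPower_induction with
  | hι v =>
    induction p with
    | zero => simp [icontr_one]
    | succ p ih =>
      rw [ιMulti_succ_apply, mul_assoc, icontr_ι_mul, icontr_ι_mul, ih]
      simp only [sub_mul, mul_add, smul_mul_assoc, mul_smul_comm, pow_succ, mul_assoc]
      simp
      abel
  | h0 => simp
  | hadd x y _ _ hx hy => simp [add_mul, hx, hy]; abel
  | hsmul r x _ hx => simp [hx, smul_comm r]

/-- Antisymmetrised insertion of covectors is adjoint to the interior product with covectors. -/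
theorem pairing_alternatizeUncurryFin {ι' : Type*} [Fintype ι'] (e : Module.Basis ι' ℝ V) {k : ℕ}
    (f : V →ₗ[ℝ] V [⋀^Fin k]→ₗ[ℝ] ℝ) (P : ExteriorAlgebra ℝ V) :
    pairing (AlternatingMap.alternatizeUncurryFin f) P =
      ∑ i, pairing (f (e i)) (icontr (e.coord i) P) := by
  -- Both sides are linear in P, so they are compared on decomposables of each degree j; both vanish
  -- unless j = k + 1.
  let R : ExteriorAlgebra ℝ V →ₗ[ℝ] ℝ := ∑ i, (pairing (f (e i))).comp (icontr (e.coord i))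
  suffices h : pairing (AlternatingMap.alternatizeUncurryFin f) = R by
    rw [h]; simp [R]
  refine lhom_ext fun j => AlternatingMap.ext fun v => ?_
  simp only [LinearMap.compAlternatingMap_apply, R, LinearMap.sum_apply, LinearMap.comp_apply]
  by_cases hj : j = k + 1
  · subst hj
    rw [pairing_ιMulti, AlternatingMap.alternatizeUncurryFin_apply]
    simp only [icontr_ιMulti, map_sum, map_smul, pairing_ιMulti]
    rw [Finset.sum_comm]
    refine Finset.sum_congr rfl fun j _ => ?_
    -- With the other slots frozen, the value is linear in the vector inserted, which can be
    -- expanded in the basis.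
    let g : V →ₗ[ℝ] ℝ :=
      { toFun := fun u => f u (j.removeNth v)
        map_add' := fun u w => by simp
        map_smul' := fun r u => by simp }
    have h' : f (v j) (j.removeNth v) = ∑ i, e.repr (v j) i * f (e i) (j.removeNth v) := by
      change g (v j) = ∑ i, e.repr (v j) i * g (e i)
      conv_lhs => rw [← e.sum_repr (v j)]
      simp only [map_sum, map_smul, smul_eq_mul]
    rw [h', Finset.smul_sum]
    exact Finset.sum_congr rfl fun i _ => by simp [mul_assoc]
  · rw [pairing_ιMulti_of_ne hj]
    refine (Finset.sum_eq_zero fun i _ => ?_).symm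
    rcases j with _ | j
    · simp [icontr_one]
    · exact pairing_eq_zero_of_mem (by omega) _ (icontr_mem _ (ιMulti_mem _ _))

theorem pairing_map {k : ℕ} (β : W [⋀^Fin k]→ₗ[ℝ] ℝ) (L : V →ₗ[ℝ] W) (P : ExteriorAlgebra ℝ V) :
    pairing β (ExteriorAlgebra.map L P) = pairing (β.compLinearMap L) P := by
  suffices h : (pairing β).comp (ExteriorAlgebra.map L).toLinearMap =
      pairing (β.compLinearMap L) from
    LinearMap.congr_fun h P
  refine lhom_ext fun j => AlternatingMap.ext fun v => ?_
  by_cases hj : j = k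
  · subst hj
    simp [map_apply_ιMulti, pairing_ιMulti]
    rfl
  · simp [map_apply_ιMulti, pairing_ιMulti_of_ne hj]

theorem map_mem (L : V →ₗ[ℝ] W) {k : ℕ} {P : ExteriorAlgebra ℝ V} (hP : P ∈ ⋀[ℝ]^k V) :
    ExteriorAlgebra.map L P ∈ ⋀[ℝ]^k W := by
  induction hP using exteriorPower_induction with
  | hι v => rw [map_apply_ιMulti]; exact ιMulti_mem _ _
  | h0 => simp
  | hadd x y _ _ hx hy => simpa using add_mem hx hy
  | hsmul r x _ hx => simpa using Submodule.smul_mem _ r hx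

theorem map_map_of_comp_eq_id {L : V →ₗ[ℝ] W} {L' : W →ₗ[ℝ] V} (h : L'.comp L = LinearMap.id)
    (P : ExteriorAlgebra ℝ V) : ExteriorAlgebra.map L' (ExteriorAlgebra.map L P) = P := by
  have := DFunLike.congr_fun (ExteriorAlgebra.map_comp_map (R := ℝ) L L') P
  rw [h, ExteriorAlgebra.map_id] at this
  exact this

end Algebra

/-! ### Multivectors of top degree and beyond. -/

section TopDegree

open ExteriorAlgebra

variable {V : Type*} [AddCommGroup V] [Module ℝ V]

theorem exteriorPower_eq_zero_of_finrank_lt [FiniteDimensional ℝ V] {k : ℕ}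
    (hk : Module.finrank ℝ V < k)
    {P : ExteriorAlgebra ℝ V} (hP : P ∈ ⋀[ℝ]^k V) : P = 0 := by
  induction hP using exteriorPower_induction with
  | hι v =>
    refine AlternatingMap.map_linearDependent _ _ fun h => ?_
    have := h.fintype_card_le_finrank
    simp at this
    omega
  | h0 => rfl
  | hadd x y _ _ hx hy => simp [hx, hy]
  | hsmul r x _ hx => simp [hx]

/-- Every top-degree form is a multiple of `e.det`, so pairing with `e.det` alone determines P. -/
theorem eq_pairing_det_smul {n : ℕ} (e : Module.Basis (Fin n) ℝ V) {P : ExteriorAlgebra ℝ V}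
    (hP : P ∈ ⋀[ℝ]^n V) : P = pairing e.det P • ιMulti ℝ n e := by
  refine eq_of_pairing_eq hP (Submodule.smul_mem _ _ (ιMulti_mem _ _)) fun β => ?_
  rw [map_smul, pairing_ιMulti, smul_eq_mul, mul_comm, ← pairing_smul,
    ← AlternatingMap.eq_smul_basis_det]

end TopDegree

/-! ### Interior product of a form with a multivector. -/

section Interior

open ExteriorAlgebra

variable {V : Type*} [AddCommGroup V] [Module ℝ V] [TopologicalSpace V] [IsTopologicalAddGroup V]
  [ContinuousSMul ℝ V] [T2Space V] [FiniteDimensional ℝ V]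

theorem interior_apply {k : ℕ} (β : V [⋀^Fin k]→L[ℝ] ℝ) (A : ExteriorAlgebra ℝ V) (m : ℕ)
    (v : Fin m → V) :
    interior β A m v = pairing β.toAlternatingMap (ιMulti ℝ m v * A) := rfl

theorem pairing_interior {k : ℕ} (β : V [⋀^Fin k]→L[ℝ] ℝ) (A : ExteriorAlgebra ℝ V) {m : ℕ}
    {P : ExteriorAlgebra ℝ V} (hP : P ∈ ⋀[ℝ]^m V) :
    pairing (interior β A m).toAlternatingMap P = pairing β.toAlternatingMap (P * A) := by
  induction hP using exteriorPower_induction with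
  | hι v => rw [pairing_ιMulti]; rfl
  | h0 => simp
  | hadd x y _ _ hx hy => simp [add_mul, hx, hy]
  | hsmul r x _ hx => simp [hx]

theorem interior_add {k : ℕ} (β : V [⋀^Fin k]→L[ℝ] ℝ) (A B : ExteriorAlgebra ℝ V) (m : ℕ) :
    interior β (A + B) m = interior β A m + interior β B m := by
  ext v; simp [interior_apply, mul_add]

theorem interior_smul {k : ℕ} (β : V [⋀^Fin k]→L[ℝ] ℝ) (r : ℝ) (A : ExteriorAlgebra ℝ V) (m : ℕ) :
    interior β (r • A) m = r • interior β A m := by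
  ext v; simp [interior_apply]

theorem interior_zero {k : ℕ} (β : V [⋀^Fin k]→L[ℝ] ℝ) (m : ℕ) :
    interior β (0 : ExteriorAlgebra ℝ V) m = 0 := by
  ext v; simp [interior_apply]

theorem interior_add_left {k : ℕ} (β γ : V [⋀^Fin k]→L[ℝ] ℝ) (A : ExteriorAlgebra ℝ V) (m : ℕ) :
    interior (β + γ) A m = interior β A m + interior γ A m := by
  ext v; simp [interior_apply, pairing_add]

theorem interior_smul_left {k : ℕ} (r : ℝ) (β : V [⋀^Fin k]→L[ℝ] ℝ) (A : ExteriorAlgebra ℝ V)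
    (m : ℕ) : interior (r • β) A m = r • interior β A m := by
  ext v; simp [interior_apply, pairing_smul]

omit [IsTopologicalAddGroup V] [ContinuousSMul ℝ V] [T2Space V] in
/-- Forms of top degree are multiples of a nonzero one. -/
theorem exists_eq_smul_of_ne_zero {n : ℕ} (hn : Module.finrank ℝ V = n) {η : V [⋀^Fin n]→L[ℝ] ℝ}
    (hη : η ≠ 0) (θ : V [⋀^Fin n]→L[ℝ] ℝ) : ∃ r : ℝ, θ = r • η := by
  let e : Module.Basis (Fin n) ℝ V := Module.finBasisOfFinrankEq ℝ V hn
  have h1 : ∀ β : V [⋀^Fin n]→L[ℝ] ℝ, β.toAlternatingMap = β e • e.det := fun β =>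
    β.toAlternatingMap.eq_smul_basis_det e
  have hηe : η e ≠ 0 := fun h => hη (by
    ext v
    have := DFunLike.congr_fun (h1 η) v
    simpa [h] using this)
  refine ⟨θ e / η e, ?_⟩
  ext v
  have hθ := DFunLike.congr_fun (h1 θ) v
  have hη := DFunLike.congr_fun (h1 η) v
  simp only [ContinuousAlternatingMap.coe_toAlternatingMap, AlternatingMap.smul_apply,
    smul_eq_mul] at hθ hη
  rw [ContinuousAlternatingMap.smul_apply, hθ, hη, smul_eq_mul]
  field_simp

/-- `d ∧ (η, P) = (-1)^m (η, d⌟P)` for `η` of top degree, in adjoint form. -/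
theorem pairing_interior_icontr {n : ℕ} (hn : Module.finrank ℝ V = n) (η : V [⋀^Fin n]→L[ℝ] ℝ)
    (d : Module.Dual ℝ V) {a m : ℕ} (hm : m + a = n) {P R : ExteriorAlgebra ℝ V}
    (hP : P ∈ ⋀[ℝ]^a V) (hR : R ∈ ⋀[ℝ]^(m + 1) V) :
    pairing (interior η P m).toAlternatingMap (icontr d R) =
      (-1) ^ m * pairing η.toAlternatingMap (R * icontr d P) := by
  -- The degree is m + 1 + a = n + 1. Applying the antiderivation to this zero product moves the
  -- contraction from R to P.
  have h0 : R * P = 0 := exteriorPower_eq_zero_of_finrank_lt (k := m + 1 + a) (by omega)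
    (SetLike.mul_mem_graded hR hP)
  have h1 := icontr_mul d hR P
  rw [h0, map_zero] at h1
  rw [pairing_interior _ _ (icontr_mem d hR), eq_neg_of_add_eq_zero_left h1.symm]
  simp [pow_succ]

end Interior

/-! ### Contraction of a multivector with a form, and the double Hodge operator. -/

section Contract

open ExteriorAlgebra

variable {V : Type*} [AddCommGroup V] [Module ℝ V] [TopologicalSpace V]

theorem contract_ιMulti {p c k : ℕ} (h : p + c = k) (α : V [⋀^Fin c]→L[ℝ] ℝ) (v : Fin k → V) :
    contract (ιMulti ℝ k v) α =
      ∑ σ : Equiv.Perm.ModSumCongr (Fin p) (Fin c),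
        TensorProduct.rid ℝ (ExteriorAlgebra ℝ V)
          (AlternatingMap.domCoprod.summand (ιMulti ℝ p) α.toAlternatingMap σ
            fun i => v (Fin.cast h (finSumFinEquiv i))) := by
  -- The definition has degree `k - c`, equal to p only propositionally; a free p' allows
  -- substitution.
  have key : ∀ (p' : ℕ) (h' : p' + c = k),
      (((TensorProduct.rid ℝ (ExteriorAlgebra ℝ V)).toLinearMap.compAlternatingMap
        ((ExteriorAlgebra.ιMulti ℝ (M := V) p').domCoprod α.toAlternatingMap)).domDomCongr
          (finSumFinEquiv.trans (finCongr h'))) v =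
      ∑ σ : Equiv.Perm.ModSumCongr (Fin p) (Fin c),
        TensorProduct.rid ℝ (ExteriorAlgebra ℝ V)
          (AlternatingMap.domCoprod.summand (ιMulti ℝ p) α.toAlternatingMap σ
            fun i => v (Fin.cast h (finSumFinEquiv i))) := by
    intro p' h'
    obtain rfl : p' = p := by omega
    simp only [AlternatingMap.domDomCongr_apply, LinearMap.compAlternatingMap_apply,
      AlternatingMap.domCoprod_apply, sum_apply, map_sum]
    rfl
  rw [contract, liftAlternating_apply_ιMulti, dif_pos (by omega : c ≤ k)]
  exact key _ _

theorem contract_eq_zero_of_lt {c k : ℕ} (h : k < c) (α : V [⋀^Fin c]→L[ℝ] ℝ)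
    {P : ExteriorAlgebra ℝ V} (hP : P ∈ ⋀[ℝ]^k V) : contract P α = 0 := by
  induction hP using exteriorPower_induction with
  | hι v => rw [contract, liftAlternating_apply_ιMulti, dif_neg (by omega)]; rfl
  | h0 => simp [contract]
  | hadd x y _ _ hx hy => simp only [contract, map_add] at *; simp [hx, hy]
  | hsmul r x _ hx => simp only [contract, map_smul] at *; simp [hx]

theorem contract_add_smul {p c k : ℕ} (h : p + c = k) {P : ExteriorAlgebra ℝ V}
    (hP : P ∈ ⋀[ℝ]^k V) (r : ℝ) (α β : V [⋀^Fin c]→L[ℝ] ℝ) :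
    contract P (α + r • β) = contract P α + r • contract P β := by
  induction hP using exteriorPower_induction with
  | hι v =>
    simp only [contract_ιMulti h, Finset.smul_sum, ← Finset.sum_add_distrib]
    refine Finset.sum_congr rfl fun σ _ => ?_
    induction σ using Quotient.inductionOn' with | _ σ
    rw [AlternatingMap.domCoprod.summand_mk'', AlternatingMap.domCoprod.summand_mk'',
      AlternatingMap.domCoprod.summand_mk'']
    simp [add_smul, mul_smul, smul_comm r]
  | h0 => simp [contract]
  | hadd x y _ _ hx hy =>
    simp only [contract, map_add] at *; rw [hx, hy, smul_add]; abel
  | hsmul s x _ hx => simp only [contract, map_smul] at *; rw [hx, smul_add, smul_comm r]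

theorem contract_zero {c k : ℕ} {P : ExteriorAlgebra ℝ V} (hP : P ∈ ⋀[ℝ]^k V) :
    contract P (0 : V [⋀^Fin c]→L[ℝ] ℝ) = 0 := by
  rcases lt_or_ge k c with h | h
  · exact contract_eq_zero_of_lt h 0 hP
  · simpa using contract_add_smul (p := k - c) (by omega) hP 1 0 0

variable [IsTopologicalAddGroup V] [ContinuousSMul ℝ V] [T2Space V] [FiniteDimensional ℝ V]

/-- Contracting `v₁ ∧ ⋯ ∧ v_k` with `(η, v₁ ∧ ⋯ ∧ v_p)`: only the trivial shuffle contributes. -/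
theorem contract_ιMulti_interior {p c k : ℕ} (h : p + c = k) (η : V [⋀^Fin k]→L[ℝ] ℝ)
    (v : Fin k → V) :
    contract (ιMulti ℝ k v)
        (interior η (ιMulti ℝ p fun i => v (Fin.cast h (Fin.castAdd c i))) c) =
      ((-1) ^ (p * c) * η v) • ιMulti ℝ p fun i => v (Fin.cast h (Fin.castAdd c i)) := by
  subst h
  have happ : ιMulti ℝ p (fun i => v (Fin.castAdd c i)) * ιMulti ℝ c (fun i => v (Fin.natAdd p i)) =
      ιMulti ℝ (p + c) v := by
    rw [ιMulti_mul_ιMulti]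
    congr 1
    exact Fin.append_castAdd_natAdd
  simp only [Fin.cast_eq_self]
  rw [contract_ιMulti rfl]
  -- The identity shuffle gives the whole value; its sign (-1)^{pc} comes from moving the last c
  -- vectors past the first p.
  refine (Finset.sum_eq_single
    (Quotient.mk'' 1 : Equiv.Perm.ModSumCongr (Fin p) (Fin c)) ?_ ?_).trans ?_
  rotate_left 2
  · rw [AlternatingMap.domCoprod.summand_mk'']
    simp only [Equiv.Perm.sign_one, one_smul, MultilinearMap.domDomCongr_apply,
      MultilinearMap.domCoprod_apply, TensorProduct.rid_tmul]
    simp only [Fin.cast_eq_self, Equiv.Perm.coe_one, id_eq, finSumFinEquiv_apply_left,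
      finSumFinEquiv_apply_right, AlternatingMap.coe_multilinearMap]
    change interior η _ c (fun j => v (Fin.natAdd p j)) • _ = _
    rw [interior_apply, mul_comm_of_mem (ιMulti_mem c _) (ιMulti_mem p _), happ, map_smul,
      pairing_ιMulti, mul_comm c p]
    rfl
  · intro σ _ hσ
    induction σ using Quotient.inductionOn' with | _ σ
    rw [AlternatingMap.domCoprod.summand_mk'']
    -- A nontrivial coset sends some slot of the form to one of the first p vectors. That vector is
    -- already present in the contracted form, so the product has a repeated factor.
    have hex : ∃ j : Fin c, ∃ i : Fin p, σ (Sum.inr j) = Sum.inl i := by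
      by_contra! hne
      refine hσ (Quotient.sound' ?_)
      rw [QuotientGroup.leftRel_apply, mul_one, inv_mem_iff]
      refine Equiv.Perm.mem_sumCongrHom_range_of_perm_mapsTo_inl
        ((Equiv.Perm.perm_mapsTo_inl_iff_mapsTo_inr σ).2 ?_)
      rintro _ ⟨j, rfl⟩
      rcases hj : σ (Sum.inr j) with i | i
      · exact (hne j i hj).elim
      · exact ⟨i, rfl⟩
    obtain ⟨j, i, hij⟩ := hex
    simp only [smul_apply, MultilinearMap.domDomCongr_apply,
      MultilinearMap.domCoprod_apply, Fin.cast_eq_self, AlternatingMap.coe_multilinearMap]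
    have h0 : interior η (ιMulti ℝ p fun i => v (Fin.castAdd c i)) c
        (fun j => v (finSumFinEquiv (σ (Sum.inr j)))) = 0 := by
      rw [interior_apply, ιMulti_mul_ιMulti, ιMulti_eq_zero_of_not_inj, map_zero]
      intro hinj
      have := @hinj (Fin.castAdd p j) (Fin.natAdd c i) (by simp [hij])
      simp only [Fin.ext_iff, Fin.val_castAdd, Fin.val_natAdd] at this
      omega
    erw [h0]
    simp
  · simp

/-- Both sides are linear in Q, so Q may be a product of p distinct basis vectors. After a
permutation these come first in the basis, ηs is a multiple of the product of the basis, and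
`contract_ιMulti_interior` applies. -/
theorem contract_interior {n p c : ℕ} (h : p + c = n) (hn : Module.finrank ℝ V = n)
    (η : V [⋀^Fin n]→L[ℝ] ℝ) {ηs : ExteriorAlgebra ℝ V} (hηs : ηs ∈ ⋀[ℝ]^n V)
    {Q : ExteriorAlgebra ℝ V} (hQ : Q ∈ ⋀[ℝ]^p V) :
    contract ηs (interior η Q c) = ((-1) ^ (p * c) * pairing η.toAlternatingMap ηs) • Q := by
  have hadd0 : ∀ α β : V [⋀^Fin c]→L[ℝ] ℝ, contract ηs (α + β) = contract ηs α + contract ηs β :=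
    fun α β => by simpa using contract_add_smul h hηs 1 α β
  have hsm0 : ∀ (r : ℝ) (β : V [⋀^Fin c]→L[ℝ] ℝ), contract ηs (r • β) = r • contract ηs β :=
    fun r β => by simpa [contract_zero hηs] using contract_add_smul h hηs r 0 β
  have key : ∀ f : Fin p → Fin n, Function.Injective f → ∀ e : Module.Basis (Fin n) ℝ V,
      contract ηs (interior η (ιMulti ℝ p (e ∘ f)) c) =
        ((-1) ^ (p * c) * pairing η.toAlternatingMap ηs) • ιMulti ℝ p (e ∘ f) := by
    intro f hf e
    -- The injection f extends to a permutation of all indices, which serves to reorder the basis.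
    obtain ⟨τ, hτ⟩ : ∃ τ : Equiv.Perm (Fin n), ∀ i, τ (Fin.cast h (Fin.castAdd c i)) = f i := by
      let ι' : Fin p → Fin n := fun i => Fin.cast h (Fin.castAdd c i)
      have hι' : Function.Injective ι' := fun i j hij => by simpa [ι', Fin.ext_iff] using hij
      let τ₀ : {x // x ∈ Set.range ι'} ≃ {x // x ∈ Set.range f} :=
        (Equiv.ofInjective ι' hι').symm.trans (Equiv.ofInjective f hf)
      refine ⟨τ₀.extendSubtype, fun i => ?_⟩
      have hi : ι' i ∈ Set.range ι' := ⟨i, rfl⟩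
      rw [show Fin.cast h (Fin.castAdd c i) = ι' i from rfl,
        Equiv.extendSubtype_apply_of_mem _ _ hi]
      have : (⟨ι' i, hi⟩ : {x // x ∈ Set.range ι'}) = Equiv.ofInjective ι' hι' i := rfl
      simp only [τ₀, this, Equiv.trans_apply, Equiv.symm_apply_apply]
      rfl
    let e' := e.reindex τ.symm
    have he' : ∀ i, e' i = e (τ i) := fun i => by simp [e']
    have hf' : e ∘ f = fun i => e' (Fin.cast h (Fin.castAdd c i)) := by
      funext i; rw [he', hτ]; rfl
    obtain ⟨s, hs⟩ : ∃ s : ℝ, ηs = s • ιMulti ℝ n e' := ⟨_, eq_pairing_det_smul e' hηs⟩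
    have hsm : ∀ α : V [⋀^Fin c]→L[ℝ] ℝ, contract (s • ιMulti ℝ n e') α =
        s • contract (ιMulti ℝ n e') α := fun α => map_smul _ _ _
    rw [hf', hs, hsm, contract_ιMulti_interior h, map_smul, pairing_ιMulti, smul_smul]
    congr 1
    simp only [smul_eq_mul, ContinuousAlternatingMap.coe_toAlternatingMap]
    ring
  let F : ExteriorAlgebra ℝ V →ₗ[ℝ] ExteriorAlgebra ℝ V :=
    { toFun := fun Q => contract ηs (interior η Q c)
      map_add' := fun x y => by rw [interior_add, hadd0]
      map_smul' := fun r x => by rw [interior_smul, hsm0]; rfl }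
  let G : ExteriorAlgebra ℝ V →ₗ[ℝ] ExteriorAlgebra ℝ V :=
    { toFun := fun Q => ((-1) ^ (p * c) * pairing η.toAlternatingMap ηs) • Q
      map_add' := fun x y => smul_add _ _ _
      map_smul' := fun r x => smul_comm _ _ _ }
  -- Alternating maps agree once they agree on injective tuples of basis vectors.
  have hFG : F.compAlternatingMap (ιMulti ℝ p) = G.compAlternatingMap (ιMulti ℝ p) :=
    Module.Basis.ext_alternating (Module.finBasisOfFinrankEq ℝ V hn) fun f hf => key f hf _
  change F Q = G Q
  induction hQ using exteriorPower_induction with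
  | hι v => exact DFunLike.congr_fun hFG v
  | h0 => rw [map_zero, map_zero]
  | hadd x y _ _ hx hy => rw [map_add, map_add, hx, hy]
  | hsmul r x _ hx => rw [map_smul, map_smul, hx]

end Contract

/-! ### Pull-back of forms, and contractions as bilinear maps. -/

section Pullback

variable {V W : Type*} [AddCommGroup V] [Module ℝ V] [TopologicalSpace V]
  [AddCommGroup W] [Module ℝ W] [TopologicalSpace W]

theorem pairing_compContinuousLinearMap {k : ℕ} (β : V [⋀^Fin k]→L[ℝ] ℝ) (L : W →L[ℝ] V)
    (P : ExteriorAlgebra ℝ W) :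
    pairing (β.compContinuousLinearMap L).toAlternatingMap P =
      pairing β.toAlternatingMap (ExteriorAlgebra.map L.toLinearMap P) :=
  (pairing_map β.toAlternatingMap L.toLinearMap P).symm

end Pullback

section BilinearMaps

variable {V W : Type*} [AddCommGroup V] [Module ℝ V] [TopologicalSpace V] [IsTopologicalAddGroup V]
  [ContinuousSMul ℝ V] [T2Space V] [FiniteDimensional ℝ V]
  [AddCommGroup W] [Module ℝ W] [TopologicalSpace W] [IsTopologicalAddGroup W]
  [ContinuousSMul ℝ W] [T2Space W] [FiniteDimensional ℝ W]

variable (V) in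
/-- The full contraction as a bilinear map. -/
noncomputable def pairingL (k : ℕ) : (V [⋀^Fin k]→L[ℝ] ℝ) →ₗ[ℝ] ExteriorAlgebra ℝ V →ₗ[ℝ] ℝ :=
  LinearMap.mk₂ ℝ (fun β P => pairing β.toAlternatingMap P)
    (fun β γ P => pairing_add β.toAlternatingMap γ.toAlternatingMap P)
    (fun r β P => pairing_smul r β.toAlternatingMap P)
    (fun _ P Q => map_add _ P Q) (fun r _ P => map_smul _ r P)

variable (V) in
/-- The interior product as a bilinear map. -/
noncomputable def interiorL (k m : ℕ) :
    (V [⋀^Fin k]→L[ℝ] ℝ) →ₗ[ℝ] ExteriorAlgebra ℝ V →ₗ[ℝ] (V [⋀^Fin m]→L[ℝ] ℝ) :=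
  LinearMap.mk₂ ℝ (fun β P => interior β P m) (fun β γ P => interior_add_left β γ P m)
    (fun r β P => interior_smul_left r β P m) (fun β P Q => interior_add β P Q m)
    (fun r β P => interior_smul β r P m)

/-- A form is recovered from its pairing functional on the exterior algebra, whose dual is
finite-dimensional. -/
instance finite_continuousAlternatingMap (k : ℕ) : Module.Finite ℝ (V [⋀^Fin k]→L[ℝ] ℝ) := by
  refine Module.Finite.of_injective (pairingL V k) fun β γ h => ?_
  ext v
  have := LinearMap.congr_fun h (ExteriorAlgebra.ιMulti ℝ k v)
  simpa [pairingL, pairing_ιMulti] using this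

/-- Pull-back of forms as a linear map. -/
noncomputable def pullbackL (k : ℕ) (L : W →L[ℝ] V) :
    (V [⋀^Fin k]→L[ℝ] ℝ) →ₗ[ℝ] (W [⋀^Fin k]→L[ℝ] ℝ) where
  toFun β := β.compContinuousLinearMap L
  map_add' _ _ := rfl
  map_smul' _ _ := rfl

theorem interior_compContinuousLinearMap {k : ℕ} (β : V [⋀^Fin k]→L[ℝ] ℝ) (L : W →L[ℝ] V)
    (P : ExteriorAlgebra ℝ W) (m : ℕ) :
    interior (β.compContinuousLinearMap L) P m =
      (interior β (ExteriorAlgebra.map L.toLinearMap P) m).compContinuousLinearMap L := by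
  ext v
  rw [interior_apply, pairing_compContinuousLinearMap, map_mul, ExteriorAlgebra.map_apply_ιMulti]
  rfl

end BilinearMaps

/-! ### Calculus tested on linear functionals, for targets such as the exterior algebra that carry
no chosen norm. -/

section WeakSmoothness

variable {E X : Type*} [NormedAddCommGroup E] [NormedSpace ℝ E] [AddCommGroup X] [Module ℝ X]

/-- Smoothness of a map with values in a vector space without chosen norm, tested on
linear functionals. -/
def WeaklySmoothOn (f : E → X) (s : Set E) : Prop :=
  ∀ l : Module.Dual ℝ X, ContDiffOn ℝ ∞ (fun z => l (f z)) s

theorem weaklySmoothOn_iff {E X : Type*} [NormedAddCommGroup E] [NormedSpace ℝ E]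
    [NormedAddCommGroup X] [NormedSpace ℝ X] [FiniteDimensional ℝ X] {f : E → X} {s : Set E} :
    WeaklySmoothOn f s ↔ ContDiffOn ℝ ∞ f s := by
  refine ⟨fun hf => ?_, fun hf l => l.toContinuousLinearMap.contDiff.comp_contDiffOn hf⟩
  let b := Module.finBasis ℝ X
  let T := b.equivFun.toContinuousLinearEquiv
  have h1 : ContDiffOn ℝ ∞ (fun z => T (f z)) s := contDiffOn_pi.2 fun i => hf (b.coord i)
  have h2 := T.symm.contDiff.comp_contDiffOn h1
  have h3 : (⇑T.symm ∘ fun z => T (f z)) = f := by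
    funext z; simp
  rwa [h3] at h2

end WeakSmoothness

section WeakCalculus

variable {E X Y Z : Type*} [NormedAddCommGroup E] [NormedSpace ℝ E] [FiniteDimensional ℝ E]
  [AddCommGroup X] [Module ℝ X] [AddCommGroup Y] [Module ℝ Y] [AddCommGroup Z] [Module ℝ Z]

/-- Differentiability of a map with values in a vector space without chosen norm, tested on
linear functionals. -/
def HasWeakDerivAt (f : E → X) (f' : E →ₗ[ℝ] X) (y : E) : Prop :=
  ∀ l : Module.Dual ℝ X, HasFDerivAt (fun z => l (f z)) (l ∘ₗ f').toContinuousLinearMap y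

theorem HasWeakDerivAt.congr {f g : E → X} {f' : E →ₗ[ℝ] X} {y : E} (hf : HasWeakDerivAt f f' y)
    (h : g =ᶠ[nhds y] f) : HasWeakDerivAt g f' y := fun l =>
  (hf l).congr_of_eventuallyEq (h.fun_comp l)

/-- Were the derivative to leave S, a functional vanishing on S would detect it, although its
composite with f is constantly zero. This keeps derivatives of homogeneous fields homogeneous. -/
theorem HasWeakDerivAt.mem {f : E → X} {f' : E →ₗ[ℝ] X} {y : E} (hf : HasWeakDerivAt f f' y)
    {S : Submodule ℝ X} (hS : ∀ z, f z ∈ S) (v : E) : f' v ∈ S := by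
  by_contra hv
  obtain ⟨l, hlv, hl⟩ := Submodule.exists_le_ker_of_notMem hv
  have h0 : (fun z => l (f z)) = fun _ => 0 := funext fun z => hl (hS z)
  have := hf l
  rw [h0] at this
  exact hlv (DFunLike.congr_fun (this.unique (hasFDerivAt_const 0 y)) v)

theorem bilin_apply_eq_sum {ι κ : Type*} [Fintype ι] [Fintype κ] (b : Module.Basis ι ℝ X)
    (c : Module.Basis κ ℝ Y) (Φ : X →ₗ[ℝ] Y →ₗ[ℝ] Z) (l : Module.Dual ℝ Z) (u : X) (w : Y) :
    l (Φ u w) = ∑ i, ∑ j, b.coord i u * c.coord j w * l (Φ (b i) (c j)) := by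
  conv_lhs => rw [← b.sum_repr u, ← c.sum_repr w]
  simp only [map_sum, LinearMap.sum_apply, map_smul, LinearMap.smul_apply, smul_eq_mul,
    Module.Basis.coord_apply, Finset.mul_sum]
  rw [Finset.sum_comm]
  exact Finset.sum_congr rfl fun i _ => Finset.sum_congr rfl fun j _ => by ring

/-- Expanding a bilinear map in bases reduces the product rule to that for real functions. -/
theorem hasWeakDerivAt_bilin [Module.Finite ℝ X] [Module.Finite ℝ Y] (Φ : X →ₗ[ℝ] Y →ₗ[ℝ] Z)
    {f : E → X} {g : E → Y} {f' : E →ₗ[ℝ] X} {g' : E →ₗ[ℝ] Y} {y : E}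
    (hf : HasWeakDerivAt f f' y) (hg : HasWeakDerivAt g g' y) :
    HasWeakDerivAt (fun z => Φ (f z) (g z)) (Φ.flip (g y) ∘ₗ f' + Φ (f y) ∘ₗ g') y := by
  intro l
  let b := Module.finBasis ℝ X
  let c := Module.finBasis ℝ Y
  have hexp := bilin_apply_eq_sum b c Φ l
  have h1 := HasFDerivAt.fun_sum (u := Finset.univ) fun i (_ : i ∈ Finset.univ) =>
    HasFDerivAt.fun_sum (u := Finset.univ) fun j (_ : j ∈ Finset.univ) =>
      (((hf (b.coord i)).mul (hg (c.coord j))).mul_const (l (Φ (b i) (c j))))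
  have h2 : (fun z => l (Φ (f z) (g z))) = fun z =>
      ∑ i, ∑ j, b.coord i (f z) * c.coord j (g z) * l (Φ (b i) (c j)) :=
    funext fun z => hexp _ _
  rw [h2]
  refine h1.congr_fderiv ?_
  ext v
  have h3 : (l ∘ₗ (Φ.flip (g y) ∘ₗ f' + Φ (f y) ∘ₗ g')).toContinuousLinearMap v =
      l (Φ (f' v) (g y)) + l (Φ (f y) (g' v)) := by simp
  rw [h3, hexp, hexp, ← Finset.sum_add_distrib]
  simp only [sum_apply, ← Finset.sum_add_distrib]
  refine Finset.sum_congr rfl fun i _ => Finset.sum_congr rfl fun j _ => ?_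
  simp
  ring

omit [FiniteDimensional ℝ E] in
theorem weaklySmoothOn_bilin [Module.Finite ℝ X] [Module.Finite ℝ Y] (Φ : X →ₗ[ℝ] Y →ₗ[ℝ] Z)
    {f : E → X} {g : E → Y} {s : Set E} (hf : WeaklySmoothOn f s) (hg : WeaklySmoothOn g s) :
    WeaklySmoothOn (fun z => Φ (f z) (g z)) s := by
  intro l
  let b := Module.finBasis ℝ X
  let c := Module.finBasis ℝ Y
  have hexp := bilin_apply_eq_sum b c Φ l
  have h2 : (fun z => l (Φ (f z) (g z))) = fun z =>
      ∑ i, ∑ j, b.coord i (f z) * c.coord j (g z) * l (Φ (b i) (c j)) :=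
    funext fun z => hexp _ _
  rw [h2]
  exact ContDiffOn.sum fun i _ => ContDiffOn.sum fun j _ =>
    ((hf _).mul (hg _)).mul contDiffOn_const

theorem WeaklySmoothOn.exists_hasWeakDerivAt [Module.Finite ℝ X] {f : E → X} {s : Set E}
    (hf : WeaklySmoothOn f s) {y : E} (hs : s ∈ nhds y) : ∃ f', HasWeakDerivAt f f' y := by
  let b := Module.finBasis ℝ X
  have hd : ∀ l : Module.Dual ℝ X, DifferentiableAt ℝ (fun z => l (f z)) y := fun l =>
    ((hf l).contDiffAt hs).differentiableAt (by simp)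
  refine ⟨∑ i, (fderiv ℝ (fun z => b.coord i (f z)) y).toLinearMap.smulRight (b i), fun l => ?_⟩
  have h2 : (fun z => l (f z)) = fun z => ∑ i, b.coord i (f z) * l (b i) := by
    funext z
    conv_lhs => rw [← b.sum_repr (f z)]
    simp only [map_sum, map_smul, smul_eq_mul, Module.Basis.coord_apply]
  rw [h2]
  refine (HasFDerivAt.fun_sum (u := Finset.univ) fun i (_ : i ∈ Finset.univ) =>
    ((hd (b.coord i)).hasFDerivAt.mul_const (l (b i)))).congr_fderiv ?_
  ext v
  simp [sum_apply, mul_comm]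

end WeakCalculus

section WeakCalculusNormed

variable {E X : Type*} [NormedAddCommGroup E] [NormedSpace ℝ E] [FiniteDimensional ℝ E]
  [NormedAddCommGroup X] [NormedSpace ℝ X] [FiniteDimensional ℝ X]

/-- The exterior derivative is built from `fderiv`, so for forms the weak derivative has to be
turned back into a Fréchet derivative. -/
theorem HasWeakDerivAt.hasFDerivAt {f : E → X} {f' : E →ₗ[ℝ] X} {y : E}
    (hf : HasWeakDerivAt f f' y) : HasFDerivAt f f'.toContinuousLinearMap y := by
  let b := Module.finBasis ℝ X
  let T := b.equivFun.toContinuousLinearEquiv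
  have h1 : HasFDerivAt (fun z => T (f z))
      (T.toContinuousLinearMap ∘L f'.toContinuousLinearMap) y := by
    rw [hasFDerivAt_pi']
    intro i
    exact (hf (b.coord i)).congr_fderiv (by ext; rfl)
  have h2 := T.symm.toContinuousLinearMap.hasFDerivAt.comp y h1
  have h3 : (⇑T.symm.toContinuousLinearMap ∘ fun z => T (f z)) = f := by
    funext z; simp
  rw [h3] at h2
  exact h2.congr_fderiv (by ext; simp)

end WeakCalculusNormed

/-! ### The Schouten bracket and the divergence at a single point. -/

section Pointwise

variable {V ι' : Type*} [AddCommGroup V] [Module ℝ V] [Fintype ι']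

/-- The Schouten bracket of multivectors `A`, `B` of degrees `a`, `b`, expressed through the
values and the derivatives of the fields at one point. -/
noncomputable def pointwiseSchouten (e : Module.Basis ι' ℝ V) (a : ℕ) (A B : ExteriorAlgebra ℝ V)
    (A' B' : V →ₗ[ℝ] ExteriorAlgebra ℝ V) : ExteriorAlgebra ℝ V :=
  ∑ i, (icontr (e.coord i) A * B' (e i) + (-1 : ℝ) ^ a • (A' (e i) * icontr (e.coord i) B))

theorem mem_multivectors_natCast {k : ℕ} {P : ExteriorAlgebra ℝ V} :
    P ∈ multivectors V (k : ℤ) ↔ P ∈ ⋀[ℝ]^k V := by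
  simp [multivectors]

theorem icontr_mem_multivectors (d : Module.Dual ℝ V) {k : ℤ} {P : ExteriorAlgebra ℝ V}
    (hP : P ∈ multivectors V k) : icontr d P ∈ multivectors V (k - 1) := by
  rcases lt_or_ge k 0 with hk | hk
  · have : P = 0 := by simpa [multivectors, not_le.2 hk] using hP
    rw [this, map_zero]
    exact zero_mem _
  · lift k to ℕ using hk
    rw [mem_multivectors_natCast] at hP
    cases k with
    | zero => rw [icontr_of_mem_zero d hP]; exact zero_mem _
    | succ k =>
      rw [Nat.cast_succ, add_sub_cancel_right, mem_multivectors_natCast]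
      exact icontr_mem d hP

theorem mul_mem_multivectors {p q : ℤ} {P Q : ExteriorAlgebra ℝ V} (hP : P ∈ multivectors V p)
    (hQ : Q ∈ multivectors V q) : P * Q ∈ multivectors V (p + q) := by
  rcases lt_or_ge p 0 with hp | hp
  · have : P = 0 := by simpa [multivectors, not_le.2 hp] using hP
    rw [this, zero_mul]
    exact zero_mem _
  rcases lt_or_ge q 0 with hq | hq
  · have : Q = 0 := by simpa [multivectors, not_le.2 hq] using hQ
    rw [this, mul_zero]
    exact zero_mem _
  lift p to ℕ using hp
  lift q to ℕ using hq
  rw [mem_multivectors_natCast] at hP hQ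
  rw [← Nat.cast_add, mem_multivectors_natCast]
  exact SetLike.mul_mem_graded hP hQ

theorem pointwiseSchouten_mem (e : Module.Basis ι' ℝ V) {a b : ℕ} {A B : ExteriorAlgebra ℝ V}
    {A' B' : V →ₗ[ℝ] ExteriorAlgebra ℝ V} (hA : A ∈ ⋀[ℝ]^a V) (hB : B ∈ ⋀[ℝ]^b V)
    (hA' : ∀ v, A' v ∈ ⋀[ℝ]^a V) (hB' : ∀ v, B' v ∈ ⋀[ℝ]^b V) :
    pointwiseSchouten e a A B A' B' ∈ multivectors V ((a : ℤ) + b - 1) := by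
  refine Submodule.sum_mem _ fun i _ => add_mem ?_ (Submodule.smul_mem _ _ ?_)
  · rw [show (a : ℤ) + b - 1 = (a - 1) + b by ring]
    exact mul_mem_multivectors (icontr_mem_multivectors _ (mem_multivectors_natCast.2 hA))
      (mem_multivectors_natCast.2 (hB' _))
  · rw [show (a : ℤ) + b - 1 = a + (b - 1) by ring]
    exact mul_mem_multivectors (mem_multivectors_natCast.2 (hA' _))
      (icontr_mem_multivectors _ (mem_multivectors_natCast.2 hB))

/-- Graded commutativity moves `d⌟B` of degree `b - 1` past `P` of degree `a`. -/
theorem icontr_mul_comm (d : Module.Dual ℝ V) {a b : ℕ} {P B : ExteriorAlgebra ℝ V}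
    (hP : P ∈ ⋀[ℝ]^a V) (hB : B ∈ ⋀[ℝ]^b V) :
    (-1 : ℝ) ^ (a * b) • (icontr d B * P) = (-1 : ℝ) ^ a • (P * icontr d B) := by
  cases b with
  | zero => simp [icontr_of_mem_zero d hB]
  | succ b =>
    rw [mul_comm_of_mem (icontr_mem d hB) hP, smul_smul, ← pow_add]
    congr 1
    rw [show a * (b + 1) + b * a = a + 2 * (a * b) by ring, pow_add, pow_mul]
    simp

/-- For a divergence operator `P ↦ -∑ᵢ eⁱ⌟(∂ᵢP + rᵢP)` the failure of the Leibniz rule is the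
Schouten bracket. -/
theorem divergence_defect (e : Module.Basis ι' ℝ V) (r : ι' → ℝ) {a : ℕ}
    {A B : ExteriorAlgebra ℝ V} {A' B' : V →ₗ[ℝ] ExteriorAlgebra ℝ V} (hA : A ∈ ⋀[ℝ]^a V)
    (hA' : ∀ v, A' v ∈ ⋀[ℝ]^a V) :
    (-∑ i, icontr (e.coord i) (A' (e i) + r i • A)) * B +
        (-1 : ℝ) ^ a • (A * -∑ i, icontr (e.coord i) (B' (e i) + r i • B)) -
        -∑ i, icontr (e.coord i) (A' (e i) * B + A * B' (e i) + r i • (A * B)) =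
      pointwiseSchouten e a A B A' B' := by
  simp only [pointwiseSchouten, neg_mul, mul_neg, sub_neg_eq_add, Finset.sum_mul, Finset.mul_sum,
    smul_neg, Finset.smul_sum]
  rw [← Finset.sum_neg_distrib, ← Finset.sum_neg_distrib, ← Finset.sum_add_distrib,
    ← Finset.sum_add_distrib]
  refine Finset.sum_congr rfl fun i _ => ?_
  simp only [map_add, map_smul, icontr_mul _ hA, icontr_mul _ (hA' _), add_mul, mul_add,
    smul_add, smul_mul_assoc, mul_smul_comm]
  rw [smul_comm (r i)]
  abel

end Pointwise

section PointwiseForms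

variable {V ι' : Type*} [AddCommGroup V] [Module ℝ V] [Fintype ι']
  [TopologicalSpace V] [IsTopologicalAddGroup V] [ContinuousSMul ℝ V] [T2Space V]
  [FiniteDimensional ℝ V]

/-- The hypothesis `hγ` is closedness in adjoint form. The antiderivation rule turns the terms
containing γ' into this sum evaluated at A∧B; the remaining terms match one by one. -/
theorem pairing_pointwiseSchouten (e : Module.Basis ι' ℝ V) {a b k : ℕ} {A B : ExteriorAlgebra ℝ V}
    {A' B' : V →ₗ[ℝ] ExteriorAlgebra ℝ V} (hA : A ∈ ⋀[ℝ]^a V) (hB : B ∈ ⋀[ℝ]^b V)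
    (hA' : ∀ v, A' v ∈ ⋀[ℝ]^a V) (γ : V [⋀^Fin k]→L[ℝ] ℝ)
    (γ' : V →ₗ[ℝ] V [⋀^Fin k]→L[ℝ] ℝ)
    (hγ : ∀ P, ∑ i, pairing (γ' (e i)).toAlternatingMap (icontr (e.coord i) P) = 0) :
    pairing γ.toAlternatingMap (pointwiseSchouten e a A B A' B') =
      ∑ i, pairing (interior (γ' (e i)) B (a - 1) +
          interior γ (B' (e i)) (a - 1)).toAlternatingMap (icontr (e.coord i) A) +
        (-1 : ℝ) ^ (a * b) * ∑ i, pairing (interior (γ' (e i)) A (b - 1) +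
          interior γ (A' (e i)) (b - 1)).toAlternatingMap (icontr (e.coord i) B) := by
  have hadd : ∀ {m : ℕ} (β δ : V [⋀^Fin m]→L[ℝ] ℝ) P, pairing (β + δ).toAlternatingMap P =
      pairing β.toAlternatingMap P + pairing δ.toAlternatingMap P := fun β δ P =>
    pairing_add β.toAlternatingMap δ.toAlternatingMap P
  -- The zero added here is dγ paired with A∧B.
  rw [← add_zero (pairing _ _), ← hγ (A * B), pointwiseSchouten, map_sum, Finset.mul_sum,
    ← Finset.sum_add_distrib, ← Finset.sum_add_distrib]
  refine Finset.sum_congr rfl fun i _ => ?_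
  have hsm : ∀ (β : V [⋀^Fin k]→L[ℝ] ℝ) {P}, P ∈ ⋀[ℝ]^a V →
      (-1 : ℝ) ^ (a * b) * pairing β.toAlternatingMap (icontr (e.coord i) B * P) =
        (-1 : ℝ) ^ a * pairing β.toAlternatingMap (P * icontr (e.coord i) B) := by
    intro β P hP
    have := congrArg (pairing β.toAlternatingMap) (icontr_mul_comm (e.coord i) hP hB)
    simpa using this
  rw [hadd, hadd, pairing_interior _ _ (icontr_mem_pred _ hA),
    pairing_interior _ _ (icontr_mem_pred _ hA), pairing_interior _ _ (icontr_mem_pred _ hB),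
    pairing_interior _ _ (icontr_mem_pred _ hB), mul_add, hsm _ hA, hsm _ (hA' _),
    icontr_mul _ hA]
  simp only [map_add, map_smul, smul_eq_mul]
  ring

/-- By `pairing_interior_icontr`, α is ±(η, Q) with Q the sum of the contractions, and contracting
ηs with it gives back Q up to sign. The prefactor ε(-1)^{na} leaves exactly -1. -/
theorem smul_contract_eq_divergence {n a : ℕ} (ha : a ≤ n) (hn : Module.finrank ℝ V = n)
    (e : Module.Basis ι' ℝ V) {ε : ℝ} (hε : ε = 1 ∨ ε = -1) (η : V [⋀^Fin n]→L[ℝ] ℝ)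
    {ηs : ExteriorAlgebra ℝ V} (hηs : ηs ∈ ⋀[ℝ]^n V) (hηε : pairing η.toAlternatingMap ηs = ε)
    {P' : ι' → ExteriorAlgebra ℝ V} (hP' : ∀ i, P' i ∈ ⋀[ℝ]^a V)
    (α : V [⋀^Fin (n - a + 1)]→L[ℝ] ℝ)
    (hα : ∀ R, pairing α.toAlternatingMap R =
      ∑ i, pairing (interior η (P' i) (n - a)).toAlternatingMap (icontr (e.coord i) R)) :
    (ε * (-1) ^ (n * a)) • contract ηs α = -∑ i, icontr (e.coord i) (P' i) := by
  rcases a with _ | a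
  -- For a = 0 the form has degree n + 1, too large to contract with an n-vector; the divergence of
  -- a function is zero as well.
  · rw [contract_eq_zero_of_lt (by omega) α hηs, smul_zero,
      Finset.sum_eq_zero fun i _ => icontr_of_mem_zero _ (hP' _), neg_zero]
  set Q := ∑ i, icontr (e.coord i) (P' i) with hQ
  have hQm : Q ∈ ⋀[ℝ]^a V := Submodule.sum_mem _ fun i _ => icontr_mem _ (hP' _)
  generalize hm' : n - (a + 1) = m at α hα
  have hm : m + (a + 1) = n := by omega
  have hαQ : α = interior η ((-1 : ℝ) ^ m • Q) (m + 1) := by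
    ext v
    have hv := ιMulti_mem (V := V) (m + 1) v
    rw [interior_apply, ← ContinuousAlternatingMap.coe_toAlternatingMap, ← pairing_ιMulti, hα,
      Finset.sum_congr rfl fun i _ => pairing_interior_icontr hn η (e.coord i) hm (hP' _) hv,
      hQ, mul_smul_comm, map_smul, smul_eq_mul, Finset.mul_sum, map_sum,
      Finset.mul_sum]
  rw [hαQ, contract_interior (p := a) (by omega) hn η hηs (Submodule.smul_mem _ _ hQm), hηε, ← hm,
    smul_smul, smul_smul, ← neg_one_smul ℝ Q]
  congr 1
  have hεε : ε * ε = 1 := by rcases hε with rfl | rfl <;> norm_num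
  -- The total exponent is odd, since a(a + 1) is even.
  have hsign : (-1 : ℝ) ^ ((m + (a + 1)) * (a + 1)) * (-1) ^ (a * (m + 1)) * (-1) ^ m = -1 := by
    rw [← pow_add, ← pow_add]
    refine Odd.neg_one_pow ?_
    rw [show (m + (a + 1)) * (a + 1) + a * (m + 1) + m =
      a * (a + 1) + 2 * (m * a + m + a) + 1 by ring]
    exact ((Nat.even_mul_succ_self a).add (even_two_mul _)).add_one
  linear_combination hεε * (-1 : ℝ) ^ ((m + (a + 1)) * (a + 1)) * (-1) ^ (a * (m + 1)) * (-1) ^ m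
    + hsign

end PointwiseForms

/-! ### Smoothness of form-valued maps. -/

section FormCalculus

/-- A form depends linearly on its finitely many values on basis tuples, through a left inverse of
the evaluation map. -/
theorem contDiffOn_of_apply {E F : Type*} [NormedAddCommGroup E] [NormedSpace ℝ E]
    [NormedAddCommGroup F] [NormedSpace ℝ F] [FiniteDimensional ℝ F] {k : ℕ}
    {f : E → F [⋀^Fin k]→L[ℝ] ℝ} {s : Set E} (hf : ∀ v, ContDiffOn ℝ ∞ (fun y => f y v) s) :
    ContDiffOn ℝ ∞ f s := by
  let b := Module.finBasis ℝ F
  let T : (F [⋀^Fin k]→L[ℝ] ℝ) →ₗ[ℝ] ((Fin k → Fin (Module.finrank ℝ F)) → ℝ) :=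
    { toFun := fun β r => β fun i => b (r i)
      map_add' := fun _ _ => rfl
      map_smul' := fun _ _ => rfl }
  have hT : LinearMap.ker T = ⊥ := by
    refine LinearMap.ker_eq_bot.2 fun β γ h => ?_
    refine ContinuousAlternatingMap.toAlternatingMap_injective
      (Module.Basis.ext_alternating b fun r _ => congrFun h r)
  obtain ⟨S, hS⟩ := T.exists_leftInverse_of_injective hT
  have h1 : ContDiffOn ℝ ∞ (fun y => T (f y)) s := contDiffOn_pi.2 fun r => hf _
  have h2 := S.toContinuousLinearMap.contDiff.comp_contDiffOn h1
  have h3 : (⇑S.toContinuousLinearMap ∘ fun y => T (f y)) = f := by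
    funext y; exact LinearMap.congr_fun hS (f y)
  rwa [h3] at h2

theorem contDiffOn_compContinuousLinearMap {E F G : Type*} [NormedAddCommGroup E] [NormedSpace ℝ E]
    [NormedAddCommGroup F] [NormedSpace ℝ F] [FiniteDimensional ℝ F]
    [NormedAddCommGroup G] [NormedSpace ℝ G] {k : ℕ} (c : G [⋀^Fin k]→L[ℝ] ℝ)
    {g : E → F →L[ℝ] G} {s : Set E} (hg : ContDiffOn ℝ ∞ g s) :
    ContDiffOn ℝ ∞ (fun y => c.compContinuousLinearMap (g y)) s := by
  refine contDiffOn_of_apply fun v => ?_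
  exact c.toContinuousMultilinearMap.contDiff.comp_contDiffOn
    (contDiffOn_pi.2 fun i => hg.clm_apply contDiffOn_const)

theorem contDiffOn_extDeriv {E : Type*} [NormedAddCommGroup E] [NormedSpace ℝ E] {k : ℕ}
    {f : E → E [⋀^Fin k]→L[ℝ] ℝ} {s : Set E} (hs : IsOpen s) (hf : ContDiffOn ℝ ∞ f s) :
    ContDiffOn ℝ ∞ (extDeriv f) s :=
  (ContinuousAlternatingMap.alternatizeUncurryFinCLM ℝ E ℝ).contDiff.comp_contDiffOn
    (hf.fderiv_of_isOpen hs (by simp))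

end FormCalculus

/-! ### Forms and multivector fields read in charts. -/

section Charts

variable {n : ℕ} {M : Type*} [TopologicalSpace M] [ChartedSpace (EuclideanSpace ℝ (Fin n)) M]

local notation "𝔼" => EuclideanSpace ℝ (Fin n)

/-- The differential at `p` of the preferred chart at `x₀`. -/
noncomputable def chartDeriv (x₀ p : M) : TangentSpace (𝓡 n) p →L[ℝ] EuclideanSpace ℝ (Fin n) :=
  mfderiv (𝓡 n) 𝓘(ℝ, EuclideanSpace ℝ (Fin n)) (extChartAt (𝓡 n) x₀) p

/-- The differential, at the image of `p`, of the inverse of the preferred chart at `x₀`. -/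
noncomputable def chartDerivSymm (x₀ p : M) :
    EuclideanSpace ℝ (Fin n) →L[ℝ] TangentSpace (𝓡 n) p :=
  mfderiv 𝓘(ℝ, EuclideanSpace ℝ (Fin n)) (𝓡 n) (extChartAt (𝓡 n) x₀).symm
    (extChartAt (𝓡 n) x₀ p)

theorem formInChart_apply {k : ℕ} (α : FormField n M k) {x₀ p : M}
    (hp : p ∈ (extChartAt (𝓡 n) x₀).source) :
    formInChart α x₀ (extChartAt (𝓡 n) x₀ p) =
      (α p).compContinuousLinearMap (chartDerivSymm x₀ p) := by
  -- The fibre depends on the base point, so the equality of points is substituted for a variable q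
  -- before anything is compared.
  have key : ∀ (y : 𝔼) (q : M), (extChartAt (𝓡 n) x₀).symm y = q → formInChart α x₀ y =
      (α q).compContinuousLinearMap
        (mfderiv 𝓘(ℝ, 𝔼) (𝓡 n) (extChartAt (𝓡 n) x₀).symm y : 𝔼 →L[ℝ] TangentSpace (𝓡 n) q) := by
    rintro y q rfl
    rfl
  exact key _ _ ((extChartAt (𝓡 n) x₀).left_inv hp)

theorem multivectorInChart_apply (A : MultivectorField n M) {x₀ p : M}
    (hp : p ∈ (extChartAt (𝓡 n) x₀).source) :
    multivectorInChart A x₀ (extChartAt (𝓡 n) x₀ p) =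
      ExteriorAlgebra.map (chartDeriv x₀ p).toLinearMap (A p) := by
  have key : ∀ q : M, q = p → ExteriorAlgebra.map (chartDeriv x₀ q).toLinearMap (A q) =
      ExteriorAlgebra.map (chartDeriv x₀ p).toLinearMap (A p) := by
    rintro q rfl
    rfl
  exact key _ ((extChartAt (𝓡 n) x₀).left_inv hp)

theorem multivectorInChart_mul (A B : MultivectorField n M) (x₀ : M) (y : 𝔼) :
    multivectorInChart (A * B) x₀ y = multivectorInChart A x₀ y * multivectorInChart B x₀ y :=
  map_mul _ _ _

variable [IsManifold (𝓡 n) ∞ M]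

theorem chartDerivSymm_comp_chartDeriv {x₀ p : M} (hp : p ∈ (extChartAt (𝓡 n) x₀).source) :
    (chartDerivSymm (n := n) x₀ p).comp (chartDeriv x₀ p) = ContinuousLinearMap.id ℝ _ := by
  have := mfderivWithin_extChartAt_symm_comp_mfderiv_extChartAt' (I := 𝓡 n) hp
  rw [ModelWithCorners.range_eq_univ, mfderivWithin_univ] at this
  exact this

theorem chartDeriv_comp_chartDerivSymm {x₀ p : M} (hp : p ∈ (extChartAt (𝓡 n) x₀).source) :
    (chartDeriv (n := n) x₀ p).comp (chartDerivSymm x₀ p) = ContinuousLinearMap.id ℝ _ := by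
  have := mfderiv_extChartAt_comp_mfderivWithin_extChartAt_symm' (I := 𝓡 n) hp
  rw [ModelWithCorners.range_eq_univ, mfderivWithin_univ] at this
  exact this

theorem map_chartDerivSymm_map_chartDeriv {x₀ p : M} (hp : p ∈ (extChartAt (𝓡 n) x₀).source)
    (P : ExteriorAlgebra ℝ (TangentSpace (𝓡 n) p)) :
    ExteriorAlgebra.map (chartDerivSymm x₀ p).toLinearMap
      (ExteriorAlgebra.map (chartDeriv x₀ p).toLinearMap P) = P :=
  map_map_of_comp_eq_id
    (congrArg ContinuousLinearMap.toLinearMap (chartDerivSymm_comp_chartDeriv hp)) P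

theorem map_chartDeriv_map_chartDerivSymm {x₀ p : M} (hp : p ∈ (extChartAt (𝓡 n) x₀).source)
    (P : ExteriorAlgebra ℝ (EuclideanSpace ℝ (Fin n))) :
    ExteriorAlgebra.map (chartDeriv x₀ p).toLinearMap
      (ExteriorAlgebra.map (chartDerivSymm x₀ p).toLinearMap P) = P :=
  map_map_of_comp_eq_id
    (congrArg ContinuousLinearMap.toLinearMap (chartDeriv_comp_chartDerivSymm hp)) P

theorem formInChart_interiorField {k : ℕ} (γ : FormField n M k) (B : MultivectorField n M) (m : ℕ)
    {x₀ p : M} (hp : p ∈ (extChartAt (𝓡 n) x₀).source) :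
    formInChart (interiorField γ B m) x₀ (extChartAt (𝓡 n) x₀ p) =
      interior (formInChart γ x₀ (extChartAt (𝓡 n) x₀ p))
        (multivectorInChart B x₀ (extChartAt (𝓡 n) x₀ p)) m := by
  rw [formInChart_apply _ hp, formInChart_apply _ hp, multivectorInChart_apply B hp,
    interior_compContinuousLinearMap, map_chartDerivSymm_map_chartDeriv hp]
  rfl

theorem pairing_formInChart {k : ℕ} (γ : FormField n M k) (C : MultivectorField n M)
    {x₀ p : M} (hp : p ∈ (extChartAt (𝓡 n) x₀).source) :
    pairing (formInChart γ x₀ (extChartAt (𝓡 n) x₀ p)).toAlternatingMap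
      (multivectorInChart C x₀ (extChartAt (𝓡 n) x₀ p)) = pairingField γ C p := by
  rw [formInChart_apply γ hp, multivectorInChart_apply C hp, pairing_compContinuousLinearMap,
    map_chartDerivSymm_map_chartDeriv hp]
  rfl

theorem contDiffAt_coordChange {x₀ x p : M} (hp : p ∈ (extChartAt (𝓡 n) x₀).source)
    (hx : p ∈ (extChartAt (𝓡 n) x).source) :
    ContDiffAt ℝ ∞ (extChartAt (𝓡 n) x ∘ (extChartAt (𝓡 n) x₀).symm)
      (extChartAt (𝓡 n) x₀ p) := by
  rw [← contMDiffAt_iff_contDiffAt]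
  have ht := (extChartAt (𝓡 n) x₀).map_source hp
  have h1 : ContMDiffAt 𝓘(ℝ, 𝔼) (𝓡 n) ∞ (extChartAt (𝓡 n) x₀).symm (extChartAt (𝓡 n) x₀ p) :=
    (contMDiffOn_extChartAt_symm x₀).contMDiffAt (extChartAt_target_mem_nhds' ht)
  refine ContMDiffAt.comp _ ?_ h1
  rw [(extChartAt (𝓡 n) x₀).left_inv hp]
  exact contMDiffAt_extChartAt' (by rwa [extChartAt_source] at hx)

theorem fderiv_comp_symm {F : M → 𝔼} {x₀ p : M} (hp : p ∈ (extChartAt (𝓡 n) x₀).source)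
    (hF : MDifferentiableAt (𝓡 n) 𝓘(ℝ, 𝔼) F p) :
    fderiv ℝ (F ∘ (extChartAt (𝓡 n) x₀).symm) (extChartAt (𝓡 n) x₀ p) =
      (mfderiv (𝓡 n) 𝓘(ℝ, 𝔼) F p : TangentSpace (𝓡 n) p →L[ℝ] 𝔼).comp (chartDerivSymm x₀ p) := by
  have ht := (extChartAt (𝓡 n) x₀).map_source hp
  have h1 : MDifferentiableAt 𝓘(ℝ, 𝔼) (𝓡 n) (extChartAt (𝓡 n) x₀).symm (extChartAt (𝓡 n) x₀ p) :=
    (mdifferentiableOn_extChartAt_symm (I := 𝓡 n) (x := x₀)).mdifferentiableAt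
      (extChartAt_target_mem_nhds' ht)
  have hinv := (extChartAt (𝓡 n) x₀).left_inv hp
  have h2 := mfderiv_comp_of_eq hF h1 hinv
  rw [mfderiv_eq_fderiv] at h2
  rw [h2]
  have key : ∀ q : M, q = p →
      (mfderiv (𝓡 n) 𝓘(ℝ, 𝔼) F q : 𝔼 →L[ℝ] 𝔼) = mfderiv (𝓡 n) 𝓘(ℝ, 𝔼) F p := by
    rintro q rfl
    rfl
  exact congrArg (fun D : 𝔼 →L[ℝ] 𝔼 => D.comp
    (mfderiv 𝓘(ℝ, 𝔼) (𝓡 n) (extChartAt (𝓡 n) x₀).symm (extChartAt (𝓡 n) x₀ p) : 𝔼 →L[ℝ] 𝔼))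
    (key _ hinv)

end Charts

theorem minSmoothness_two_le_infty : minSmoothness ℝ 2 ≤ ∞ := by
  rw [minSmoothness_of_isRCLikeNormedField]
  exact WithTop.coe_le_coe.2 (le_top : (2 : ℕ∞) ≤ ⊤)

/-! ### The exterior derivative on the manifold, and a supply of closed forms. -/

section ExteriorDerivative

variable {n : ℕ} {M : Type*} [TopologicalSpace M] [ChartedSpace (EuclideanSpace ℝ (Fin n)) M]

local notation "𝔼" => EuclideanSpace ℝ (Fin n)

theorem exists_eq_extChartAt {x₀ : M} {y : 𝔼} (hy : y ∈ (extChartAt (𝓡 n) x₀).target) :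
    ∃ p ∈ (extChartAt (𝓡 n) x₀).source, extChartAt (𝓡 n) x₀ p = y :=
  ⟨(extChartAt (𝓡 n) x₀).symm y, (extChartAt (𝓡 n) x₀).map_target hy,
    (extChartAt (𝓡 n) x₀).right_inv hy⟩

theorem extDerivative_apply {k : ℕ} (α : FormField n M k) (x : M) :
    extDerivative α x = (extDeriv (formInChart α x) (extChartAt (𝓡 n) x x)).compContinuousLinearMap
      (chartDeriv x x) := rfl

theorem extDerivative_zero {k : ℕ} : extDerivative (0 : FormField n M k) = 0 := by
  funext x
  have h : formInChart (0 : FormField n M k) x = fun _ => 0 := by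
    funext y; rfl
  rw [extDerivative_apply, h]
  have : extDeriv (fun _ : 𝔼 => (0 : 𝔼 [⋀^Fin k]→L[ℝ] ℝ)) (extChartAt (𝓡 n) x x) = 0 := by
    ext v
    simp [extDeriv, ContinuousAlternatingMap.alternatizeUncurryFin_apply]
  rw [this]
  rfl

theorem IsSmoothForm.differentiableAt {k : ℕ} {α : FormField n M k} (hα : IsSmoothForm α)
    {x₀ p : M} (hp : p ∈ (extChartAt (𝓡 n) x₀).source) :
    DifferentiableAt ℝ (formInChart α x₀) (extChartAt (𝓡 n) x₀ p) :=
  ((hα x₀).contDiffAt (extChartAt_target_mem_nhds'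
    ((extChartAt (𝓡 n) x₀).map_source hp))).differentiableAt (by simp)

theorem eventually_symm_mem_source {x₀ p : M} (hp : p ∈ (extChartAt (𝓡 n) x₀).source)
    {s : Set M} (hs : s ∈ nhds p) :
    ∀ᶠ y in nhds (extChartAt (𝓡 n) x₀ p), ∃ q ∈ (extChartAt (𝓡 n) x₀).source,
      extChartAt (𝓡 n) x₀ q = y ∧ q ∈ s := by
  have ht := (extChartAt (𝓡 n) x₀).map_source hp
  have hc : ContinuousAt (extChartAt (𝓡 n) x₀).symm (extChartAt (𝓡 n) x₀ p) :=
    continuousAt_extChartAt_symm'' ht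
  have hs' : s ∈ nhds ((extChartAt (𝓡 n) x₀).symm (extChartAt (𝓡 n) x₀ p)) := by
    rwa [(extChartAt (𝓡 n) x₀).left_inv hp]
  filter_upwards [hc.preimage_mem_nhds hs', extChartAt_target_mem_nhds' ht] with y hy hyt
  exact ⟨_, (extChartAt (𝓡 n) x₀).map_target hyt, (extChartAt (𝓡 n) x₀).right_inv hyt, hy⟩

variable [IsManifold (𝓡 n) ∞ M]

/-- The exterior derivative does not depend on the chart used to compute it. -/
theorem formInChart_extDerivative {k : ℕ} {α : FormField n M k} (hα : IsSmoothForm α)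
    {x₀ p : M} (hp : p ∈ (extChartAt (𝓡 n) x₀).source) :
    formInChart (extDerivative α) x₀ (extChartAt (𝓡 n) x₀ p) =
      extDeriv (formInChart α x₀) (extChartAt (𝓡 n) x₀ p) := by
  have hpp := mem_extChartAt_source (I := 𝓡 n) p
  have hinv := (extChartAt (𝓡 n) x₀).left_inv hp
  set T : 𝔼 → 𝔼 := extChartAt (𝓡 n) p ∘ (extChartAt (𝓡 n) x₀).symm with hT
  have hd : ∀ {q}, q ∈ (extChartAt (𝓡 n) x₀).source → q ∈ (extChartAt (𝓡 n) p).source →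
      fderiv ℝ T (extChartAt (𝓡 n) x₀ q) = (chartDeriv p q).comp (chartDerivSymm x₀ q) := by
    intro q hq hq'
    refine fderiv_comp_symm hq (mdifferentiableAt_extChartAt ?_)
    rwa [extChartAt_source] at hq'
  -- Near p the two local expressions differ by pull-back along the transition map T, and `extDeriv`
  -- commutes with pull-backs.
  have hev : formInChart α x₀ =ᶠ[nhds (extChartAt (𝓡 n) x₀ p)]
      fun y => (formInChart α p (T y)).compContinuousLinearMap (fderiv ℝ T y) := by
    filter_upwards [eventually_symm_mem_source hp (extChartAt_source_mem_nhds (I := 𝓡 n) p)]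
      with y hy
    obtain ⟨q, hq, rfl, hq'⟩ := hy
    have hTq : T (extChartAt (𝓡 n) x₀ q) = extChartAt (𝓡 n) p q := by
      rw [hT, Function.comp_apply, (extChartAt (𝓡 n) x₀).left_inv hq]
    rw [hTq, formInChart_apply α hq, formInChart_apply α hq', hd hq hq']
    ext v
    have := fun w => DFunLike.congr_fun (chartDerivSymm_comp_chartDeriv hq') w
    simp only [ContinuousLinearMap.comp_apply, ContinuousLinearMap.id_apply] at this
    simp [Function.comp_def, this]
  have hTp : T (extChartAt (𝓡 n) x₀ p) = extChartAt (𝓡 n) p p := by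
    rw [hT, Function.comp_apply, hinv]
  have hTc : ContDiffAt ℝ ∞ T (extChartAt (𝓡 n) x₀ p) := contDiffAt_coordChange hp hpp
  rw [hev.extDeriv_eq, extDeriv_pullback (by rw [hTp]; exact hα.differentiableAt hpp)
    hTc minSmoothness_two_le_infty, hTp, hd hp hpp, formInChart_apply _ hp]
  rfl

theorem IsSmoothForm.extDerivative {k : ℕ} {α : FormField n M k} (hα : IsSmoothForm α) :
    IsSmoothForm (extDerivative α) := by
  intro x₀
  refine (contDiffOn_extDeriv (isOpen_extChartAt_target x₀) (hα x₀)).congr fun y hy => ?_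
  obtain ⟨p, hp, rfl⟩ := exists_eq_extChartAt hy
  exact formInChart_extDerivative hα hp

/-- The pull-back of a constant form along a map into Euclidean space. -/
noncomputable def pullbackForm {k : ℕ} (F : M → EuclideanSpace ℝ (Fin n))
    (c : EuclideanSpace ℝ (Fin n) [⋀^Fin k]→L[ℝ] ℝ) : FormField n M k := fun p =>
  c.compContinuousLinearMap (mfderiv (𝓡 n) 𝓘(ℝ, EuclideanSpace ℝ (Fin n)) F p :
    TangentSpace (𝓡 n) p →L[ℝ] EuclideanSpace ℝ (Fin n))

theorem contDiffOn_comp_symm {F : M → 𝔼} (hF : ContMDiff (𝓡 n) 𝓘(ℝ, 𝔼) ∞ F) (x₀ : M) :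
    ContDiffOn ℝ ∞ (F ∘ (extChartAt (𝓡 n) x₀).symm) (extChartAt (𝓡 n) x₀).target := by
  rw [← contMDiffOn_iff_contDiffOn]
  exact hF.comp_contMDiffOn (contMDiffOn_extChartAt_symm x₀)

theorem formInChart_pullbackForm {k : ℕ} {F : M → 𝔼} (hF : ContMDiff (𝓡 n) 𝓘(ℝ, 𝔼) ∞ F)
    (c : 𝔼 [⋀^Fin k]→L[ℝ] ℝ) {x₀ : M} {y : 𝔼} (hy : y ∈ (extChartAt (𝓡 n) x₀).target) :
    formInChart (pullbackForm F c) x₀ y =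
      c.compContinuousLinearMap (fderiv ℝ (F ∘ (extChartAt (𝓡 n) x₀).symm) y) := by
  obtain ⟨p, hp, rfl⟩ := exists_eq_extChartAt hy
  rw [formInChart_apply _ hp, fderiv_comp_symm hp (hF.mdifferentiableAt (by simp))]
  rfl

theorem isSmoothForm_pullbackForm {k : ℕ} {F : M → 𝔼} (hF : ContMDiff (𝓡 n) 𝓘(ℝ, 𝔼) ∞ F)
    (c : 𝔼 [⋀^Fin k]→L[ℝ] ℝ) : IsSmoothForm (pullbackForm F c) := fun x₀ =>
  (contDiffOn_compContinuousLinearMap c ((contDiffOn_comp_symm hF x₀).fderiv_of_isOpen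
    (isOpen_extChartAt_target x₀) (by simp))).congr fun _ hy => formInChart_pullbackForm hF c hy

/-- In a chart this is the pull-back of a constant form, whose derivative is zero. -/
theorem extDerivative_pullbackForm {k : ℕ} {F : M → 𝔼} (hF : ContMDiff (𝓡 n) 𝓘(ℝ, 𝔼) ∞ F)
    (c : 𝔼 [⋀^Fin k]→L[ℝ] ℝ) : extDerivative (pullbackForm F c) = 0 := by
  funext x
  have hev : formInChart (pullbackForm F c) x =ᶠ[nhds (extChartAt (𝓡 n) x x)] fun y =>
      ((fun _ => c : 𝔼 → _) ((F ∘ (extChartAt (𝓡 n) x).symm) y)).compContinuousLinearMap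
        (fderiv ℝ (F ∘ (extChartAt (𝓡 n) x).symm) y) := by
    filter_upwards [extChartAt_target_mem_nhds (I := 𝓡 n) x] with y hy
    exact formInChart_pullbackForm hF c hy
  have h0 : ∀ z : 𝔼, extDeriv (fun _ : 𝔼 => c) z = 0 := fun z => by
    ext v
    simp [extDeriv, ContinuousAlternatingMap.alternatizeUncurryFin_apply]
  rw [extDerivative_apply, hev.extDeriv_eq, extDeriv_pullback
    (differentiableAt_const c) ((contDiffOn_comp_symm hF x).contDiffAt
      (extChartAt_target_mem_nhds x)) minSmoothness_two_le_infty, h0]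
  rfl

/-- Charts extend, near a point, to global smooth maps. -/
theorem exists_contMDiff_eventuallyEq_extChartAt [T2Space M] {x₀ p : M}
    (hp : p ∈ (extChartAt (𝓡 n) x₀).source) :
    ∃ F : M → 𝔼, ContMDiff (𝓡 n) 𝓘(ℝ, 𝔼) ∞ F ∧ F =ᶠ[nhds p] extChartAt (𝓡 n) x₀ := by
  have hs : (extChartAt (𝓡 n) x₀).source ∈ nhds p := (isOpen_extChartAt_source x₀).mem_nhds hp
  obtain ⟨f, hf, -⟩ := (SmoothBumpFunction.nhds_basis_support (I := 𝓡 n) hs).mem_iff.1 hs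
  -- The bump function equals 1 near p, and its closed support lies in the chart domain, so the
  -- product extended by zero is smooth on all of M. Hausdorffness enters here.
  refine ⟨fun q => f q • extChartAt (𝓡 n) x₀ q, contMDiff_of_tsupport fun q hq => ?_, ?_⟩
  · have hq' : q ∈ (extChartAt (𝓡 n) x₀).source := hf (tsupport_smul_subset_left _ _ hq)
    rw [extChartAt_source] at hq'
    exact f.contMDiff.contMDiffAt.smul (contMDiffAt_extChartAt' hq')
  · filter_upwards [f.eventuallyEq_one] with q hq
    simp [hq]

end ExteriorDerivative

/-! ### Derivatives of fields at a point, transported to the tangent space. -/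

section Derivatives

variable {n : ℕ} {M : Type*} [TopologicalSpace M] [ChartedSpace (EuclideanSpace ℝ (Fin n)) M]

local notation "𝔼" => EuclideanSpace ℝ (Fin n)

/-- `α'` is the derivative at `x` of the form field `α`, in the preferred chart at `x`. -/
def HasFormDerivAt {k : ℕ} (α : FormField n M k) (x : M)
    (α' : TangentSpace (𝓡 n) x →ₗ[ℝ] TangentSpace (𝓡 n) x [⋀^Fin k]→L[ℝ] ℝ) : Prop :=
  HasWeakDerivAt (formInChart α x)
    (pullbackL k (chartDerivSymm x x) ∘ₗ α' ∘ₗ (chartDerivSymm x x).toLinearMap)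
    (extChartAt (𝓡 n) x x)

/-- `A'` is the derivative at `x` of the multivector field `A`, in the preferred chart at `x`. -/
def HasMultivectorDerivAt (A : MultivectorField n M) (x : M)
    (A' : TangentSpace (𝓡 n) x →ₗ[ℝ] ExteriorAlgebra ℝ (TangentSpace (𝓡 n) x)) : Prop :=
  HasWeakDerivAt (multivectorInChart A x)
    ((ExteriorAlgebra.map (chartDeriv x x).toLinearMap).toLinearMap ∘ₗ A' ∘ₗ
      (chartDerivSymm x x).toLinearMap)
    (extChartAt (𝓡 n) x x)

variable [IsManifold (𝓡 n) ∞ M]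

theorem chartDerivSymm_chartDeriv (x : M) (v : TangentSpace (𝓡 n) x) :
    chartDerivSymm x x (chartDeriv x x v) = v :=
  DFunLike.congr_fun (chartDerivSymm_comp_chartDeriv (mem_extChartAt_source x)) v

theorem chartDeriv_chartDerivSymm (x : M) (v : 𝔼) :
    chartDeriv x x (chartDerivSymm x x v) = v :=
  DFunLike.congr_fun (chartDeriv_comp_chartDerivSymm (mem_extChartAt_source x)) v

/-- The chart differentials cancel, leaving the alternatization of α', to which
`pairing_alternatizeUncurryFin` applies: this is dα = ∑ e^i ∧ ∂_i α in adjoint form. -/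
theorem pairing_extDerivative {k : ℕ} {α : FormField n M k} {x : M}
    {α' : TangentSpace (𝓡 n) x →ₗ[ℝ] TangentSpace (𝓡 n) x [⋀^Fin k]→L[ℝ] ℝ}
    (hα : HasFormDerivAt α x α') {ι' : Type*} [Fintype ι']
    (e : Module.Basis ι' ℝ (TangentSpace (𝓡 n) x))
    (P : ExteriorAlgebra ℝ (TangentSpace (𝓡 n) x)) :
    pairing (extDerivative α x).toAlternatingMap P =
      ∑ i, pairing (α' (e i)).toAlternatingMap (icontr (e.coord i) P) := by
  let f : TangentSpace (𝓡 n) x →ₗ[ℝ] TangentSpace (𝓡 n) x [⋀^Fin k]→ₗ[ℝ] ℝ :=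
    { toFun := fun v => (α' v).toAlternatingMap
      map_add' := fun v w => by rw [map_add]; rfl
      map_smul' := fun r v => by rw [map_smul]; rfl }
  have h : (extDerivative α x).toAlternatingMap = AlternatingMap.alternatizeUncurryFin f := by
    ext v
    rw [extDerivative_apply, extDeriv, hα.hasFDerivAt.fderiv,
      AlternatingMap.alternatizeUncurryFin_apply]
    simp only [ContinuousAlternatingMap.coe_toAlternatingMap,
      ContinuousAlternatingMap.compContinuousLinearMap_apply,
      ContinuousAlternatingMap.alternatizeUncurryFin_apply]
    refine Finset.sum_congr rfl fun j _ => ?_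
    congr 1
    change α' (chartDerivSymm x x (chartDeriv x x (v j)))
      (fun i => chartDerivSymm x x (chartDeriv x x (j.removeNth v i))) = α' (v j) (j.removeNth v)
    simp only [chartDerivSymm_chartDeriv]
  rw [h]
  exact pairing_alternatizeUncurryFin e f P

theorem HasFormDerivAt.interiorField {k : ℕ} {γ : FormField n M k} {B : MultivectorField n M}
    {x : M} {γ' : TangentSpace (𝓡 n) x →ₗ[ℝ] TangentSpace (𝓡 n) x [⋀^Fin k]→L[ℝ] ℝ}
    {B' : TangentSpace (𝓡 n) x →ₗ[ℝ] ExteriorAlgebra ℝ (TangentSpace (𝓡 n) x)}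
    (hγ : HasFormDerivAt γ x γ') (hB : HasMultivectorDerivAt B x B') (m : ℕ) :
    HasFormDerivAt (interiorField γ B m) x
      ((interiorL _ k m).flip (B x) ∘ₗ γ' + interiorL _ k m (γ x) ∘ₗ B') := by
  have hx := mem_extChartAt_source (I := 𝓡 n) x
  have h := hasWeakDerivAt_bilin (interiorL 𝔼 k m) hγ hB
  have hev : formInChart (LeibnizSchouten.interiorField γ B m) x =ᶠ[nhds (extChartAt (𝓡 n) x x)]
      fun y => interiorL 𝔼 k m (formInChart γ x y) (multivectorInChart B x y) := by
    filter_upwards [extChartAt_target_mem_nhds (I := 𝓡 n) x] with y hy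
    obtain ⟨p, hp, rfl⟩ := exists_eq_extChartAt hy
    exact formInChart_interiorField γ B m hp
  have h' := h.congr hev
  rw [formInChart_apply γ hx, multivectorInChart_apply B hx] at h'
  refine (congrArg (fun D => HasWeakDerivAt _ D _) ?_).mp h'
  ext1 v
  have h1 : ∀ (β : TangentSpace (𝓡 n) x [⋀^Fin k]→L[ℝ] ℝ) P,
      interior (β.compContinuousLinearMap (chartDerivSymm x x))
        (ExteriorAlgebra.map (chartDeriv x x).toLinearMap P) m =
      (interior β P m).compContinuousLinearMap (chartDerivSymm x x) := fun β P => by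
    rw [interior_compContinuousLinearMap, map_chartDerivSymm_map_chartDeriv hx]
  exact congrArg₂ (· + ·) (h1 (γ' (chartDerivSymm x x v)) (B x))
    (h1 (γ x) (B' (chartDerivSymm x x v)))

omit [IsManifold (𝓡 n) ∞ M] in
theorem HasMultivectorDerivAt.mul {A B : MultivectorField n M} {x : M}
    {A' B' : TangentSpace (𝓡 n) x →ₗ[ℝ] ExteriorAlgebra ℝ (TangentSpace (𝓡 n) x)}
    (hA : HasMultivectorDerivAt A x A') (hB : HasMultivectorDerivAt B x B') :
    HasMultivectorDerivAt (A * B) x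
      ((LinearMap.mul ℝ _).flip (B x) ∘ₗ A' + LinearMap.mul ℝ _ (A x) ∘ₗ B') := by
  have hx := mem_extChartAt_source (I := 𝓡 n) x
  have h := hasWeakDerivAt_bilin (LinearMap.mul ℝ (ExteriorAlgebra ℝ 𝔼)) hA hB
  rw [multivectorInChart_apply A hx, multivectorInChart_apply B hx] at h
  refine (congrArg (fun D => HasWeakDerivAt (multivectorInChart (A * B) x) D _) ?_).mp
    (h.congr (Filter.Eventually.of_forall (multivectorInChart_mul A B x)))
  ext1 v
  simp

theorem IsSmoothForm.exists_hasFormDerivAt {k : ℕ} {α : FormField n M k} (hα : IsSmoothForm α)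
    (x : M) : ∃ α', HasFormDerivAt α x α' := by
  obtain ⟨f', hf'⟩ := (weaklySmoothOn_iff.2 (hα x)).exists_hasWeakDerivAt
    (extChartAt_target_mem_nhds x)
  refine ⟨pullbackL k (chartDeriv x x) ∘ₗ f' ∘ₗ (chartDeriv x x).toLinearMap, ?_⟩
  refine (congrArg (fun D => HasWeakDerivAt _ D _) ?_).mp hf'
  ext v w
  change f' v w = f' (chartDeriv x x (chartDerivSymm x x v))
    fun i => chartDeriv x x (chartDerivSymm x x (w i))
  simp only [chartDeriv_chartDerivSymm]

theorem IsMultivectorField.exists_hasMultivectorDerivAt {a : ℕ} {A : MultivectorField n M}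
    (hA : IsMultivectorField (a : ℤ) A) (x : M) :
    ∃ A', HasMultivectorDerivAt A x A' ∧ ∀ v, A' v ∈ ⋀[ℝ]^a (TangentSpace (𝓡 n) x) := by
  have hx := mem_extChartAt_source (I := 𝓡 n) x
  obtain ⟨f', hf'⟩ := WeaklySmoothOn.exists_hasWeakDerivAt (hA.smooth x)
    (extChartAt_target_mem_nhds x)
  refine ⟨(ExteriorAlgebra.map (chartDerivSymm x x).toLinearMap).toLinearMap ∘ₗ f' ∘ₗ
    (chartDeriv x x).toLinearMap, ?_, fun v => map_mem _ ?_⟩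
  · refine (congrArg (fun D => HasWeakDerivAt _ D _) ?_).mp hf'
    ext1 v
    change f' v = ExteriorAlgebra.map (chartDeriv x x).toLinearMap
      (ExteriorAlgebra.map (chartDerivSymm x x).toLinearMap
        (f' (chartDeriv x x (chartDerivSymm x x v))))
    rw [map_chartDeriv_map_chartDerivSymm hx, chartDeriv_chartDerivSymm]
  · exact hf'.mem (fun y => map_mem _ (mem_multivectors_natCast.1 (hA.mem _))) _

end Derivatives

/-! ### The codifferential on homogeneous fields, and its divergence formula. -/

section Codifferential

variable {n : ℕ} {M : Type*} [TopologicalSpace M] [ChartedSpace (EuclideanSpace ℝ (Fin n)) M]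

theorem finrank_tangentSpace (x : M) : Module.finrank ℝ (TangentSpace (𝓡 n) x) = n :=
  finrank_euclideanSpace_fin (𝕜 := ℝ)

theorem component_eq_self {a : ℕ} {A : MultivectorField n M}
    (hA : ∀ x, A x ∈ ⋀[ℝ]^a (TangentSpace (𝓡 n) x)) : component a A = A := by
  funext x
  rw [component, GradedAlgebra.proj_apply]
  exact DirectSum.decompose_of_mem_same _ (hA x)

theorem component_eq_zero {a b : ℕ} (h : a ≠ b) {A : MultivectorField n M}
    (hA : ∀ x, A x ∈ ⋀[ℝ]^a (TangentSpace (𝓡 n) x)) : component b A = 0 := by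
  funext x
  rw [component, GradedAlgebra.proj_apply]
  exact DirectSum.decompose_of_mem_ne _ (hA x) h

theorem codifferential_of_homogeneous {ε : ℝ} {η : FormField n M n} {ηs : MultivectorField n M}
    (hηs : ∀ x, ηs x ∈ ⋀[ℝ]^n (TangentSpace (𝓡 n) x)) {a : ℕ} (ha : a ≤ n)
    {A : MultivectorField n M} (hA : ∀ x, A x ∈ ⋀[ℝ]^a (TangentSpace (𝓡 n) x)) (x : M) :
    codifferential ε η ηs A x =
      (ε * (-1) ^ (n * a)) • contract (ηs x) (extDerivative (interiorField η A (n - a)) x) := by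
  rw [codifferential, Finset.sum_eq_single a]
  · rw [component_eq_self hA]
    rfl
  · intro b _ hb
    have h0 : hodgeMultivector η b (0 : MultivectorField n M) = 0 := by
      funext y
      exact interior_zero (η y) (n - b)
    rw [component_eq_zero hb.symm hA, h0, extDerivative_zero]
    funext y
    change (_ : ℝ) • contract (ηs y) 0 = 0
    rw [contract_zero (hηs y), smul_zero]
  · intro h
    exact absurd (Finset.mem_range.2 (by omega)) h

theorem codifferential_of_lt {ε : ℝ} {η : FormField n M n} {ηs : MultivectorField n M}
    (hηs : ∀ x, ηs x ∈ ⋀[ℝ]^n (TangentSpace (𝓡 n) x)) {a : ℕ} (ha : n < a)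
    {A : MultivectorField n M} (hA : ∀ x, A x ∈ ⋀[ℝ]^a (TangentSpace (𝓡 n) x)) (x : M) :
    codifferential ε η ηs A x = 0 := by
  have hA0 : ∀ y, A y = 0 := fun y =>
    exteriorPower_eq_zero_of_finrank_lt (by rwa [finrank_tangentSpace]) (hA y)
  -- Above top degree A is zero, hence homogeneous of every degree; degree 0 is a convenient choice.
  rw [codifferential_of_homogeneous hηs (Nat.zero_le n) (a := 0)
    (fun y => by rw [hA0]; exact zero_mem _)]
  have h0 : interiorField η A (n - 0) = 0 := by
    funext y
    rw [interiorField, hA0]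
    exact interior_zero (η y) _
  rw [h0, extDerivative_zero]
  change (_ : ℝ) • contract (ηs x) 0 = 0
  rw [contract_zero (hηs x), smul_zero]

variable [IsManifold (𝓡 n) ∞ M]

/-- The codifferential as a divergence. -/
theorem codifferential_apply {ε : ℝ} (hε : ε = 1 ∨ ε = -1) {η : FormField n M n}
    {ηs : MultivectorField n M} (hηs : IsDualVolumeElement ε η ηs) {a : ℕ}
    {A : MultivectorField n M} (hA : ∀ x, A x ∈ ⋀[ℝ]^a (TangentSpace (𝓡 n) x)) {x : M}
    {η' : TangentSpace (𝓡 n) x →ₗ[ℝ] TangentSpace (𝓡 n) x [⋀^Fin n]→L[ℝ] ℝ}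
    (hη' : HasFormDerivAt η x η')
    {A' : TangentSpace (𝓡 n) x →ₗ[ℝ] ExteriorAlgebra ℝ (TangentSpace (𝓡 n) x)}
    (hA' : HasMultivectorDerivAt A x A') (hA'm : ∀ v, A' v ∈ ⋀[ℝ]^a (TangentSpace (𝓡 n) x))
    {ι' : Type*} [Fintype ι'] (e : Module.Basis ι' ℝ (TangentSpace (𝓡 n) x)) (r : ι' → ℝ)
    (hr : ∀ i, η' (e i) = r i • η x) :
    codifferential ε η ηs A x = -∑ i, icontr (e.coord i) (A' (e i) + r i • A x) := by
  have hm : ∀ y, ηs y ∈ ⋀[ℝ]^n (TangentSpace (𝓡 n) y) := fun y =>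
    mem_multivectors_natCast.1 (hηs y).1
  rcases lt_or_ge n a with ha | ha
  · have h0 : ∀ P ∈ ⋀[ℝ]^a (TangentSpace (𝓡 n) x), P = 0 := fun P hP =>
      exteriorPower_eq_zero_of_finrank_lt (by rwa [finrank_tangentSpace]) hP
    rw [codifferential_of_lt hm ha hA, Finset.sum_eq_zero, neg_zero]
    intro i _
    rw [h0 _ (hA'm _), h0 _ (hA x), smul_zero, add_zero, map_zero]
  · rw [codifferential_of_homogeneous hm ha hA]
    refine smul_contract_eq_divergence ha (finrank_tangentSpace x) e hε (η x) (hm x) (hηs x).2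
      (P' := fun i => A' (e i) + r i • A x)
      (fun i => add_mem (hA'm _) (Submodule.smul_mem _ _ (hA x))) _ fun R => ?_
    rw [pairing_extDerivative (hη'.interiorField hA' (n - a)) e]
    refine Finset.sum_congr rfl fun i _ => ?_
    have h : ((interiorL (TangentSpace (𝓡 n) x) n (n - a)).flip (A x) ∘ₗ η' +
        interiorL (TangentSpace (𝓡 n) x) n (n - a) (η x) ∘ₗ A') (e i) =
        interior (η x) (A' (e i) + r i • A x) (n - a) := by
      change interior (η' (e i)) (A x) (n - a) + interior (η x) (A' (e i)) (n - a) = _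
      rw [hr, interior_smul_left, interior_add, interior_smul, add_comm]
    rw [h]

end Codifferential

/-! ### Existence, uniqueness and smoothness of the Schouten bracket. -/

section Schouten

variable {n : ℕ} {M : Type*} [TopologicalSpace M] [ChartedSpace (EuclideanSpace ℝ (Fin n)) M]

local notation "𝔼" => EuclideanSpace ℝ (Fin n)

theorem IsMultivectorField.mem_exteriorPower {a : ℕ} {A : MultivectorField n M}
    (hA : IsMultivectorField (a : ℤ) A) (x : M) : A x ∈ ⋀[ℝ]^a (TangentSpace (𝓡 n) x) :=
  mem_multivectors_natCast.1 (hA.mem x)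

theorem multivectors_of_add_eq_zero {a b : ℕ} (h : a + b = 0) (V : Type*) [AddCommGroup V]
    [Module ℝ V] : multivectors V ((a : ℤ) + b - 1) = ⊥ := by
  rw [multivectors, if_neg (by omega)]

theorem multivectors_of_add_eq_succ {a b k : ℕ} (h : k + 1 = a + b) (V : Type*) [AddCommGroup V]
    [Module ℝ V] : multivectors V ((a : ℤ) + b - 1) = ⋀[ℝ]^k V := by
  rw [multivectors, if_pos (by omega), show ((a : ℤ) + b - 1).toNat = k by omega]

/-- The right-hand side of the defining identity of the Schouten bracket. -/
noncomputable def schoutenFunctional (a b : ℕ) (A B : MultivectorField n M) {k : ℕ}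
    (γ : FormField n M k) : M → ℝ :=
  pairingField (extDerivative (interiorField γ B (a - 1))) A +
    (-1 : ℝ) ^ (a * b) • pairingField (extDerivative (interiorField γ A (b - 1))) B

variable [IsManifold (𝓡 n) ∞ M]

theorem IsSmoothForm.interiorField {k b : ℕ} {γ : FormField n M k} (hγ : IsSmoothForm γ)
    {B : MultivectorField n M} (hB : IsMultivectorField (b : ℤ) B) (m : ℕ) :
    IsSmoothForm (interiorField γ B m) := by
  intro x₀
  refine (weaklySmoothOn_iff.1 (weaklySmoothOn_bilin (interiorL 𝔼 k m)
    (weaklySmoothOn_iff.2 (hγ x₀)) (hB.smooth x₀))).congr fun y hy => ?_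
  obtain ⟨p, hp, rfl⟩ := exists_eq_extChartAt hy
  exact formInChart_interiorField γ B m hp

theorem contDiffOn_pairingField {k a : ℕ} {γ : FormField n M k} (hγ : IsSmoothForm γ)
    {A : MultivectorField n M} (hA : IsMultivectorField (a : ℤ) A) (x₀ : M) :
    ContDiffOn ℝ ∞ (fun y => pairingField γ A ((extChartAt (𝓡 n) x₀).symm y))
      (extChartAt (𝓡 n) x₀).target := by
  refine (weaklySmoothOn_iff.1 (weaklySmoothOn_bilin (pairingL 𝔼 k)
    (weaklySmoothOn_iff.2 (hγ x₀)) (hA.smooth x₀))).congr fun y hy => ?_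
  obtain ⟨p, hp, rfl⟩ := exists_eq_extChartAt hy
  rw [(extChartAt (𝓡 n) x₀).left_inv hp]
  exact (pairing_formInChart γ A hp).symm

theorem contDiffOn_schoutenFunctional {k a b : ℕ} {γ : FormField n M k} (hγ : IsSmoothForm γ)
    {A B : MultivectorField n M} (hA : IsMultivectorField (a : ℤ) A)
    (hB : IsMultivectorField (b : ℤ) B) (x₀ : M) :
    ContDiffOn ℝ ∞ (fun y => schoutenFunctional a b A B γ ((extChartAt (𝓡 n) x₀).symm y))
      (extChartAt (𝓡 n) x₀).target :=
  (contDiffOn_pairingField (hγ.interiorField hB (a - 1)).extDerivative hA x₀).add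
    ((contDiffOn_pairingField (hγ.interiorField hA (b - 1)).extDerivative hB x₀).const_smul
      ((-1 : ℝ) ^ (a * b)))

theorem pairingField_eq_schoutenFunctional {k a b : ℕ} {γ : FormField n M k}
    (hγ : IsSmoothForm γ) {A B : MultivectorField n M} (hA : IsMultivectorField (a : ℤ) A)
    (hB : IsMultivectorField (b : ℤ) B) {x : M} (hγx : extDerivative γ x = 0)
    {A' B' : TangentSpace (𝓡 n) x →ₗ[ℝ] ExteriorAlgebra ℝ (TangentSpace (𝓡 n) x)}
    (hA' : HasMultivectorDerivAt A x A') (hA'm : ∀ v, A' v ∈ ⋀[ℝ]^a (TangentSpace (𝓡 n) x))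
    (hB' : HasMultivectorDerivAt B x B')
    {ι' : Type*} [Fintype ι'] (e : Module.Basis ι' ℝ (TangentSpace (𝓡 n) x)) :
    pairing (γ x).toAlternatingMap (pointwiseSchouten e a (A x) (B x) A' B') =
      schoutenFunctional a b A B γ x := by
  obtain ⟨γ', hγ'⟩ := hγ.exists_hasFormDerivAt x
  rw [pairing_pointwiseSchouten e (hA.mem_exteriorPower x) (hB.mem_exteriorPower x) hA'm (γ x) γ'
    fun P => by
      rw [← pairing_extDerivative hγ' e, hγx]
      exact pairing_zero P]
  change _ = pairing (extDerivative _ x).toAlternatingMap (A x) + (-1 : ℝ) ^ (a * b) *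
    pairing (extDerivative _ x).toAlternatingMap (B x)
  rw [pairing_extDerivative (hγ'.interiorField hB' (a - 1)) e,
    pairing_extDerivative (hγ'.interiorField hA' (b - 1)) e]
  rfl

variable [T2Space M]

/-- Every alternating form at a point extends to a global closed smooth form; near the point it is
constant in a given chart. -/
theorem exists_closed_form {k : ℕ} (c : 𝔼 [⋀^Fin k]→L[ℝ] ℝ) {x₀ p : M}
    (hp : p ∈ (extChartAt (𝓡 n) x₀).source) :
    ∃ γ : FormField n M k, IsSmoothForm γ ∧ extDerivative γ = 0 ∧
      ∀ᶠ q in nhds p, γ q = c.compContinuousLinearMap (chartDeriv x₀ q) := by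
  obtain ⟨F, hF, hFp⟩ := exists_contMDiff_eventuallyEq_extChartAt hp
  refine ⟨pullbackForm F c, isSmoothForm_pullbackForm hF c, extDerivative_pullbackForm hF c, ?_⟩
  filter_upwards [hFp.eventuallyEq_nhds] with q hq
  rw [pullbackForm, chartDeriv, hq.mfderiv_eq]

/-- Closed forms take arbitrary values at a point, and these values separate multivectors of degree
a + b - 1. In degree -1 both brackets are zero. -/
theorem IsSchoutenBracket.unique {a b : ℕ} {A B C C' : MultivectorField n M}
    (hC : IsSchoutenBracket a b A B C) (hC' : IsSchoutenBracket a b A B C') : C = C' := by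
  funext x
  have hm := hC.1.mem x
  have hm' := hC'.1.mem x
  rcases Nat.eq_zero_or_pos (a + b) with h0 | h0
  · rw [multivectors_of_add_eq_zero h0, Submodule.mem_bot] at hm hm'
    rw [hm, hm']
  · obtain ⟨k, hk⟩ : ∃ k, k + 1 = a + b := ⟨a + b - 1, by omega⟩
    rw [multivectors_of_add_eq_succ hk] at hm hm'
    refine eq_of_pairing_eq hm hm' fun β => ?_
    have hx := mem_extChartAt_source (I := 𝓡 n) x
    let β' : TangentSpace (𝓡 n) x [⋀^Fin k]→L[ℝ] ℝ := { β with cont := continuous_alternating β }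
    obtain ⟨γ, hγ, hdγ, hγx⟩ :=
      exists_closed_form (β'.compContinuousLinearMap (chartDerivSymm x x)) hx
    have hβ : γ x = β' := by
      rw [hγx.self_of_nhds]
      ext v
      change β' (fun i => chartDerivSymm x x (chartDeriv x x (v i))) = β' v
      simp only [chartDerivSymm_chartDeriv]
    have h1 := congrFun ((hC.2 k hk γ hγ hdγ).trans (hC'.2 k hk γ hγ hdγ).symm) x
    rw [pairingField, pairingField, hβ] at h1
    exact h1

/-- A field of multivectors that represents the functional of the Schouten bracket on closed forms
is smooth. -/
theorem isSchoutenBracket_of_pairing {a b : ℕ} {A B C : MultivectorField n M}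
    (hA : IsMultivectorField (a : ℤ) A) (hB : IsMultivectorField (b : ℤ) B)
    (hm : ∀ x, C x ∈ multivectors (TangentSpace (𝓡 n) x) ((a : ℤ) + b - 1))
    (hC : ∀ (k : ℕ) (γ : FormField n M k), IsSmoothForm γ → extDerivative γ = 0 →
      pairingField γ C = schoutenFunctional a b A B γ) : IsSchoutenBracket a b A B C := by
  refine ⟨⟨hm, fun x₀ l => ?_⟩, fun k _ γ hγ hdγ => hC k γ hγ hdγ⟩
  rcases Nat.eq_zero_or_pos (a + b) with h0 | h0
  · refine contDiffOn_const (c := (0 : ℝ)) |>.congr fun y _ => ?_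
    have := hm ((extChartAt (𝓡 n) x₀).symm y)
    rw [multivectors_of_add_eq_zero h0, Submodule.mem_bot] at this
    rw [multivectorInChart, this, map_zero]
    exact map_zero l
  obtain ⟨k, hk⟩ : ∃ k, k + 1 = a + b := ⟨a + b - 1, by omega⟩
  simp only [multivectors_of_add_eq_succ hk] at hm
  -- The functional l restricted to degree k, viewed as a constant form. Near p the l-component of C
  -- is the pairing of C with a closed form extending c, which `hC` equates with a smooth function.
  let c : 𝔼 [⋀^Fin k]→L[ℝ] ℝ :=
    { l.compAlternatingMap (ExteriorAlgebra.ιMulti ℝ k) with cont := continuous_alternating _ }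
  intro y hy
  obtain ⟨p, hp, rfl⟩ := exists_eq_extChartAt hy
  obtain ⟨γ, hγ, hdγ, hγp⟩ := exists_closed_form c hp
  have h1 := (contDiffOn_schoutenFunctional hγ hA hB x₀).contDiffAt
    (extChartAt_target_mem_nhds' hy)
  refine (h1.congr_of_eventuallyEq ?_).contDiffWithinAt
  filter_upwards [eventually_symm_mem_source hp hγp] with z hz
  obtain ⟨q, hq, rfl, hγq⟩ := hz
  rw [multivectorInChart_apply C hq, (extChartAt (𝓡 n) x₀).left_inv hq, ← hC k γ hγ hdγ,
    dual_apply_eq_pairing l (map_mem _ (hm q))]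
  rw [pairingField, hγq]
  exact (pairing_compContinuousLinearMap c (chartDeriv x₀ q) (C q)).symm

end Schouten

end LeibnizSchouten

/-! ### The theorem. -/

theorem theorem3 (n : ℕ) (M : Type*) [TopologicalSpace M] [T2Space M]
    [ChartedSpace (EuclideanSpace ℝ (Fin n)) M] [IsManifold (𝓡 n) ∞ M]
    (ε : ℝ) (hε : ε = 1 ∨ ε = -1)
    (η : FormField n M n) (hη : IsVolumeElement η)
    (ηs : MultivectorField n M) (hηs : IsDualVolumeElement ε η ηs)
    (a b : ℕ) (A B : MultivectorField n M)
    (hA : IsMultivectorField (a : ℤ) A) (hB : IsMultivectorField (b : ℤ) B) :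
    (∃! C : MultivectorField n M, IsSchoutenBracket a b A B C) ∧
    schoutenBracket a b A B =
      (-1 : ℝ) ^ a •
        leibnizBracket (-1) 0 (codifferential ε η ηs) (fun P Q => P * Q) (a : ℤ) A B ∧
    schoutenBracket a b A B =
      codifferential ε η ηs A * B + (-1 : ℝ) ^ a • (A * codifferential ε η ηs B)
        - codifferential ε η ηs (A * B) := by
  set C : MultivectorField n M :=
    codifferential ε η ηs A * B + (-1 : ℝ) ^ a • (A * codifferential ε η ηs B)
      - codifferential ε η ηs (A * B) with hCdef
  have hloc : ∀ x, ∃ A' B', HasMultivectorDerivAt A x A' ∧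
      (∀ v, A' v ∈ ⋀[ℝ]^a (TangentSpace (𝓡 n) x)) ∧ HasMultivectorDerivAt B x B' ∧
      (∀ v, B' v ∈ ⋀[ℝ]^b (TangentSpace (𝓡 n) x)) ∧
      C x = pointwiseSchouten (Module.finBasis ℝ (TangentSpace (𝓡 n) x)) a (A x) (B x) A' B' := by
    intro x
    obtain ⟨A', hA', hA'm⟩ := hA.exists_hasMultivectorDerivAt x
    obtain ⟨B', hB', hB'm⟩ := hB.exists_hasMultivectorDerivAt x
    obtain ⟨η', hη'⟩ := hη.1.exists_hasFormDerivAt x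
    refine ⟨A', B', hA', hA'm, hB', hB'm, ?_⟩
    let e := Module.finBasis ℝ (TangentSpace (𝓡 n) x)
    -- The r_i are the logarithmic derivatives of η along the basis at x, available because
    -- top-degree forms are multiples of the nonzero form `η x`.
    choose r hr using fun i =>
      exists_eq_smul_of_ne_zero (finrank_tangentSpace x) (hη.2 x) (η' (e i))
    have hAm := fun x => hA.mem_exteriorPower x
    have hBm := fun x => hB.mem_exteriorPower x
    have h1 := codifferential_apply hε hηs hAm hη' hA' hA'm e r hr
    have h2 := codifferential_apply hε hηs hBm hη' hB' hB'm e r hr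
    have h3 := codifferential_apply hε hηs (A := A * B)
      (fun x => SetLike.mul_mem_graded (hAm x) (hBm x)) hη' (hA'.mul hB')
      (fun v => add_mem (SetLike.mul_mem_graded (hA'm v) (hBm x))
        (SetLike.mul_mem_graded (hAm x) (hB'm v))) e r hr
    rw [← divergence_defect e r (hAm x) hA'm, ← h1, ← h2]
    exact congrArg (fun Z => codifferential ε η ηs A x * B x +
      (-1 : ℝ) ^ a • (A x * codifferential ε η ηs B x) - Z) h3
  have hC : IsSchoutenBracket a b A B C := by
    refine isSchoutenBracket_of_pairing hA hB (fun x => ?_) fun k γ hγ hdγ => ?_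
    · obtain ⟨A', B', -, hA'm, -, hB'm, h⟩ := hloc x
      rw [h]
      exact pointwiseSchouten_mem _ (hA.mem_exteriorPower x) (hB.mem_exteriorPower x) hA'm hB'm
    · funext x
      obtain ⟨A', B', hA', hA'm, hB', -, h⟩ := hloc x
      rw [pairingField, h]
      exact pairingField_eq_schoutenFunctional hγ hA hB (congrFun hdγ x) hA' hA'm hB' _
  have hs : schoutenBracket a b A B = C :=
    (Classical.epsilon_spec (p := IsSchoutenBracket a b A B) ⟨C, hC⟩).unique hC
  refine ⟨⟨C, hC, fun C' hC' => hC'.unique hC⟩, ?_, hs⟩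
  rw [hs, hCdef, leibnizBracket]
  -- With p = -1 and k = 0 the sign of the Leibniz bracket is (-1)^{-a} = (-1)^a, and the outer
  -- factor (-1)^a squares it to 1.
  have hsign : ((-1 : ℤ) * ((a : ℤ) + 0)).negOnePow •
      (codifferential ε η ηs A * B - codifferential ε η ηs (A * B)) = (-1 : ℝ) ^ a •
      (codifferential ε η ηs A * B - codifferential ε η ηs (A * B)) := by
    rw [add_zero, neg_one_mul, Int.negOnePow_neg, Int.negOnePow_def, zpow_natCast]
    rcases Nat.even_or_odd a with ha | ha
    · simp [ha.neg_one_pow]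
    · simp [ha.neg_one_pow]
  rw [hsign, smul_add, smul_smul, ← mul_pow]
  simp only [neg_mul_neg, mul_one, one_pow, one_smul]
  abel
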